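/- Let $\mathbb{E}$ be a simple Euclidean Jordan algebra, i.e. a nonzero finite-dimensional real inner product space with a commutative bilinear product $xy$ and a unit $e$ such that $x(x^2y)=x^2(xy)$ and $\langle x,yz\rangle=\langle xy,z\rangle$ for all $x,y,z$, which is not the Cartesian product of two Euclidean Jordan algebras of positive dimension. Let $\Omega$ be the interior of $\{x^2 : x\in\mathbb{E}\}$ (an irreducible symmetric cone), let $G$ be the connected component of the identity in the group of linear automorphisms of $\mathbb{E}$ that map $\Omega$ onto $\Omega$, and let $K=G\cap O(\mathbb{E})$. Write $\mathcal{D}=\{x\in\Omega : e-x\in\Omega\}$ and $\mathcal{D}_0=\{(x,y)\in\mathcal{D}\times\mathcal{D} : x+y\in\mathcal{D}\}$. For $x=\sum_{i=1}^r\lambda_i c_i$, where $\lambda_i\in\mathbb{R}$ and $(c_1,\dots,c_r)$ is a complete system of primitive orthogonal idempotents, put $\det x=\prod_{i=1}^r\lambda_i$. A multiplication algorithm is a map $w:\Omega\to G$ with $w(x)e=x$ for all $x\in\Omega$. Let $w,\widetilde w$ be two multiplication algorithms, each of which satisfies: (A) $w(sx)=s\,w(x)$ for all $s>0$ and $x\in\Omega$;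 (B) $\lim_{x\to e}w(x)=w(e)$; (C) the map $\Omega\ni x\mapsto w(x)^{-1}e\in\Omega$ is surjective. Let $f,g,h,k:\mathcal{D}\to\mathbb{R}$ be continuous functions such that $$f(x)+g\bigl(w(e-x)^{-1}y\bigr)=h(y)+k\bigl(\widetilde w(e-y)^{-1}x\bigr)\qquad\text{for all }(x,y)\in\mathcal{D}_0 .$$ Suppose that at least two of the four functions $f,g,h,k$ (any two) are $K$-invariant, i.e. $\varphi(ux)=\varphi(x)$ for all $u\in K$ and $x\in\mathcal{D}$. Then there exist real constants $\kappa_1,\kappa_2,\kappa_3$ and $C_1,C_2,C_3,C_4$ with $C_1+C_2=C_3+C_4$ such that for every $x\in\mathcal{D}$ $$\begin{aligned} f(x)&=\kappa_1\log\det(e-x)+\kappa_2\log\det x+\kappa_3\log\det(e-x)+C_1,\\ g(x)&=\kappa_1\log\det(e-x)+\kappa_3\log\det x+C_2,\\ h(x)&=\kappa_1\log\det(e-x)+\kappa_2\log\det(e-x)+\kappa_3\log\det x+C_3,\\ k(x)&=\kappa_1\log\det(e-x)+\kappa_2\log\det x+C_4. \end{aligned}$$ -/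

import Mathlib

open Filter Topology

/-- A (real) Euclidean Jordan algebra structure on a Euclidean space `E`: a commutative bilinear
product with unit, satisfying the Jordan identity, for which the inner product is associative.
Finite dimensionality of `E` is the separate class `FiniteDimensional ℝ E`. -/
class EuclideanJordanAlgebra (E : Type*) [NormedAddCommGroup E] [InnerProductSpace ℝ E] where
  /-- the Jordan product -/
  mul : E →ₗ[ℝ] E →ₗ[ℝ] E
  /-- the neutral element -/
  unit : E
  mul_comm : ∀ x y : E, mul x y = mul y x
  jordan : ∀ x y : E, mul x (mul (mul x x) y) = mul (mul x x) (mul x y)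
  mul_unit : ∀ x : E, mul x unit = x
  inner_mul : ∀ x y z : E, inner ℝ x (mul y z) = inner ℝ (mul x y) z

namespace EuclideanJordanAlgebra

section

variable (E : Type*) [NormedAddCommGroup E] [InnerProductSpace ℝ E] [EuclideanJordanAlgebra E]

/-- The algebra is simple: it is nonzero, and it is not the (internal) Cartesian product of two
ideals of positive dimension. -/
structure IsSimple : Prop where
  nontrivial : Nontrivial E
  eq_bot_or_eq_bot : ∀ I J : Submodule ℝ E,
    (∀ x : E, ∀ y ∈ I, mul x y ∈ I) → (∀ x : E, ∀ y ∈ J, mul x y ∈ J) →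
    IsCompl I J → I = ⊥ ∨ J = ⊥

/-- The symmetric cone: the interior of the set of Jordan squares. -/
def cone : Set E := interior {z : E | ∃ x : E, z = mul x x}

/-- The group of all (continuous) linear automorphisms of `E` which map the cone onto itself. -/
noncomputable def coneAut : Subgroup (E →L[ℝ] E)ˣ where
  carrier := {g | (g : E →L[ℝ] E) '' cone E = cone E}
  one_mem' := by simp
  mul_mem' := by
    intro a b ha hb
    change (fun v => (a : E →L[ℝ] E) ((b : E →L[ℝ] E) v)) '' cone E = cone E
    rw [← Set.image_image, show (b : E →L[ℝ] E) '' cone E = cone E from hb]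
    exact ha
  inv_mem' := by
    intro a ha
    change ((a⁻¹ : (E →L[ℝ] E)ˣ) : E →L[ℝ] E) '' cone E = cone E
    have hinv : ∀ v : E, ((a⁻¹ : (E →L[ℝ] E)ˣ) : E →L[ℝ] E) ((a : E →L[ℝ] E) v) = v :=
      fun v => congrArg (fun T : E →L[ℝ] E => T v) a.inv_mul
    conv_lhs => rw [← show (a : E →L[ℝ] E) '' cone E = cone E from ha]
    rw [Set.image_image]
    simp [hinv]

/-- The group `G`: the connected component of the identity in `coneAut E`, as a subgroup of the
general linear group. -/
noncomputable def G : Subgroup (E →L[ℝ] E)ˣ :=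
  (Subgroup.connectedComponentOfOne (coneAut E)).map (coneAut E).subtype

/-- The group `K = G ∩ O(E)`. -/
def K : Set (E →L[ℝ] E)ˣ :=
  {g | g ∈ G E ∧ ∀ x y : E, inner ℝ ((g : E →L[ℝ] E) x) ((g : E →L[ℝ] E) y) = inner ℝ x y}

/-- The "interval" `D = {x ∈ V : e - x ∈ V}`. -/
def D : Set E := {x | x ∈ cone E ∧ unit - x ∈ cone E}

/-- The domain `D₀ = {(a, b) ∈ D × D : a + b ∈ D}` of the functional equation. -/
def D₀ : Set (E × E) := {p | p.1 ∈ D E ∧ p.2 ∈ D E ∧ p.1 + p.2 ∈ D E}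

end

section

variable {E : Type*} [NormedAddCommGroup E] [InnerProductSpace ℝ E] [EuclideanJordanAlgebra E]

/-- Idempotents are nonzero by convention. -/
def IsIdem (c : E) : Prop := mul c c = c ∧ c ≠ 0

/-- A primitive idempotent is one which is not the sum of two idempotents. -/
def IsPrimitive (c : E) : Prop :=
  IsIdem c ∧ ¬ ∃ a b : E, IsIdem a ∧ IsIdem b ∧ c = a + b

/-- A complete system of primitive orthogonal idempotents. -/
structure IsCompleteSystem {r : ℕ} (c : Fin r → E) : Prop where
  primitive : ∀ i, IsPrimitive (c i)
  orthogonal : ∀ i j, i ≠ j → mul (c i) (c j) = 0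
  sum_eq_unit : ∑ i, c i = unit

/-- `d` is the product of the eigenvalues of `x` read off from some spectral decomposition
`x = ∑ i, l i • c i`. -/
def IsDet (x : E) (d : ℝ) : Prop :=
  ∃ (r : ℕ) (c : Fin r → E) (l : Fin r → ℝ),
    IsCompleteSystem c ∧ x = ∑ i, l i • c i ∧ d = ∏ i, l i

open Classical in
/-- The determinant of `x`: the product of the eigenvalues in a spectral decomposition of `x`.
(Every `x` has such a decomposition, and the product does not depend on it; the value `0` in the
other case is never taken in a finite-dimensional algebra.) -/
noncomputable def det (x : E) : ℝ :=
  if hx : ∃ d, IsDet x d then hx.choose else 0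

/-- A multiplication algorithm: a map `w : V → G` with `w(x) e = x`. Only the values of `w` on
the cone matter. -/
structure IsMultiplicationAlgorithm (w : E → (E →L[ℝ] E)ˣ) : Prop where
  mem_G : ∀ x ∈ cone E, w x ∈ G E
  apply_unit : ∀ x ∈ cone E, (w x : E →L[ℝ] E) unit = x

/-- Homogeneity of degree one (condition A), continuity at the unit (condition B), and
surjectivity of `V ∋ x ↦ w(x)⁻¹ e ∈ V` (condition C). -/
structure SatisfiesABC (w : E → (E →L[ℝ] E)ˣ) : Prop where
  homogeneous : ∀ s : ℝ, 0 < s → ∀ x ∈ cone E,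
    (w (s • x) : E →L[ℝ] E) = s • (w x : E →L[ℝ] E)
  continuous_at_unit : Tendsto (fun x => (w x : E →L[ℝ] E)) (𝓝[cone E] unit)
    (𝓝 (w unit : E →L[ℝ] E))
  surjective : ∀ y ∈ cone E, ∃ x ∈ cone E, (((w x)⁻¹ : (E →L[ℝ] E)ˣ) : E →L[ℝ] E) unit = y

/-- Invariance under the group `K` of a function on `D`. -/
def IsKInvariant (f : E → ℝ) : Prop :=
  ∀ u ∈ K E, ∀ x ∈ D E, f ((u : E →L[ℝ] E) x) = f x

end

end EuclideanJordanAlgebra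

/-! The proof reduces the equation on the cone to one on an open box in `Fin r → ℝ`, by invariance
under the automorphisms in `G` that fix the unit `e`.

Algebra. The stabilizer must be orthogonal, and all primitive idempotents must look alike to a
continuous invariant function. Both come from maximizing `⟨x, d⟩` over the closure of the orbit of a
primitive idempotent under the flows `exp [L(a), L(b)]`: a maximizer commutes with `d`, hence is
orthogonal to `d` or equal to it, and simplicity excludes the first case for the whole orbit
(`primitive_dichotomy`, `IsSimple.mem_closure_orbit`). Primitive idempotents therefore have equal
norm, and a cone automorphism in `G` fixing `e`, which sends frames to frames, lies in `K`
(`IsSimple.mem_unitStabilizer`).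

Asymptotics. Replace `x` by `αx` and let `α → 0`. The function `f` may have no limit, but the
differences `f(αb) - f(αe)` converge to a function `μ` that turns the multiplication algorithm into
addition, and `h(y) = g(w(e)⁻¹ y) + μ(e - y) + c` (`exists_logarithmic`). Exchanging the two sides
gives `ν` with `f(x) = k(w'(e)⁻¹ x) + ν(e - x) + c'`. These relations spread invariance from any two
of the functions to all four (`invariant_of_two`).

Reduction. On a frame an invariant function sees `w(x)⁻¹` as coordinatewise division. With `p(x) =
k(e - x) - μ(e - x)` and `q(x) = g(e - x) - ν(e - x)` the equation becomes `p(x) + q((x+y-1)/x) =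
q(y) + p((x+y-1)/y) + c` on the box; its continuous solutions are sums of logarithms with common
coefficients (`eq_logSum_of_equation`). The functions `μ` and `ν` are such sums as well.
Transitivity on primitive idempotents makes all coefficients equal and independent of the frame, so
`p`, `μ`, `ν` are multiples of `log det` up to constants; the multiples are `κ₁`, `κ₂`, `κ₃`. -/

set_option linter.unusedSectionVars false

namespace EuclideanJordanAlgebra

/-! ### Jordan identities, positivity of idempotents, powers -/

section Identities

variable {E : Type*} [NormedAddCommGroup E] [InnerProductSpace ℝ E] [EuclideanJordanAlgebra E]

local infixl:70 " ⊙ " => EuclideanJordanAlgebra.mul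

/-- The fully linearized Jordan identity. -/
theorem linearized_jordan (a b c y : E) :
    a ⊙ ((b ⊙ c) ⊙ y) + b ⊙ ((c ⊙ a) ⊙ y) + c ⊙ ((a ⊙ b) ⊙ y) =
      (b ⊙ c) ⊙ (a ⊙ y) + (c ⊙ a) ⊙ (b ⊙ y) + (a ⊙ b) ⊙ (c ⊙ y) := by
  have h1 := jordan (a + b + c) y
  have h2 := jordan (a + b) y
  have h3 := jordan (b + c) y
  have h4 := jordan (c + a) y
  have h5 := jordan a y
  have h6 := jordan b y
  have h7 := jordan c y
  simp only [map_add, LinearMap.add_apply, mul_comm b a, mul_comm c b, mul_comm a c] at *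
  linear_combination (norm := module) (1 / 2 : ℝ) • (h1 - h2 - h3 - h4 + h5 + h6 + h7)

/-- The right-hand side of the linearized identity, applied to `b`, is symmetric in `a` and `b`; so
the left-hand side is too. -/
theorem linearized_jordan_symm (a b s t : E) :
    a ⊙ ((s ⊙ t) ⊙ b) + s ⊙ ((t ⊙ a) ⊙ b) + t ⊙ ((a ⊙ s) ⊙ b) =
      b ⊙ ((s ⊙ t) ⊙ a) + s ⊙ ((t ⊙ b) ⊙ a) + t ⊙ ((b ⊙ s) ⊙ a) := by
  rw [linearized_jordan, linearized_jordan]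
  simp only [mul_comm a b, mul_comm t b, mul_comm s b, mul_comm t a, mul_comm s a]
  rw [mul_comm (a ⊙ t) (b ⊙ s), mul_comm (b ⊙ t) (a ⊙ s)]
  abel

/-- The commutator of two multiplication operators is a derivation. -/
theorem commutator_derivation (a b s t : E) :
    a ⊙ (b ⊙ (s ⊙ t)) - b ⊙ (a ⊙ (s ⊙ t)) =
      (a ⊙ (b ⊙ s) - b ⊙ (a ⊙ s)) ⊙ t + s ⊙ (a ⊙ (b ⊙ t) - b ⊙ (a ⊙ t)) := by
  have h := linearized_jordan_symm a b s t
  rw [mul_comm (s ⊙ t) b, mul_comm (s ⊙ t) a, mul_comm (t ⊙ a) b, mul_comm (t ⊙ b) a,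
    mul_comm (a ⊙ s) b, mul_comm (b ⊙ s) a, mul_comm t a, mul_comm t b] at h
  rw [mul_comm (a ⊙ (b ⊙ s) - b ⊙ (a ⊙ s)) t]
  simp only [map_sub]
  linear_combination (norm := module) h

/-- This annihilating polynomial `2t³ - 3t² + t` confines the eigenvalues of `L(c)` to `0`, `1/2`,
`1`. -/
theorem peirce_identity {c : E} (hc : c ⊙ c = c) (z : E) :
    (2 : ℝ) • (c ⊙ (c ⊙ (c ⊙ z))) - (3 : ℝ) • (c ⊙ (c ⊙ z)) + c ⊙ z = 0 := by
  have h := linearized_jordan c c z c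
  rw [hc, mul_comm z c, mul_comm (c ⊙ z) c, mul_comm z (c ⊙ c), hc] at h
  linear_combination (norm := module) h

theorem inner_mul_left (a x y : E) : inner ℝ (a ⊙ x) y = inner ℝ x (a ⊙ y) := by
  rw [inner_mul, mul_comm a x]

/-- The relation `t = t² + 4(t - t²)²` holds at the three Peirce eigenvalues. It exhibits `L(c)` as
a sum of squares, which avoids the Peirce decomposition itself. -/
theorem inner_mul_self_eq {c : E} (hc : c ⊙ c = c) (z : E) :
    inner ℝ (c ⊙ z) z = ‖c ⊙ z‖ ^ 2 + 4 * ‖c ⊙ z - c ⊙ (c ⊙ z)‖ ^ 2 := by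
  have h3 : (2 : ℝ) • (c ⊙ (c ⊙ (c ⊙ z))) = (3 : ℝ) • (c ⊙ (c ⊙ z)) - c ⊙ z := by
    linear_combination (norm := module) peirce_identity hc z
  have h4 : inner ℝ (c ⊙ z) (c ⊙ z) = inner ℝ z (c ⊙ (c ⊙ z)) := inner_mul_left _ _ _
  have h5 := congrArg (fun u => inner ℝ z u) h3
  have h6 := congrArg (fun u => inner ℝ (c ⊙ z) u) h3
  simp only [inner_sub_right, inner_smul_right] at h5 h6
  rw [← inner_mul_left c z (c ⊙ (c ⊙ z))] at h5
  rw [← inner_mul_left c (c ⊙ z) (c ⊙ (c ⊙ z))] at h6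
  rw [← real_inner_self_eq_norm_sq, ← real_inner_self_eq_norm_sq, inner_sub_left,
    inner_sub_right, inner_sub_right, real_inner_comm (c ⊙ z) (c ⊙ (c ⊙ z)),
    real_inner_comm z (c ⊙ z)]
  linarith

theorem inner_mul_self_nonneg {c : E} (hc : c ⊙ c = c) (z : E) : 0 ≤ inner ℝ (c ⊙ z) z := by
  rw [inner_mul_self_eq hc]; positivity

theorem mul_eq_zero_of_inner_eq_zero {c z : E} (hc : c ⊙ c = c) (hz : inner ℝ (c ⊙ z) z = 0) :
    c ⊙ z = 0 := by
  rw [inner_mul_self_eq hc] at hz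
  have : ‖c ⊙ z‖ ^ 2 = 0 := by nlinarith [sq_nonneg ‖c ⊙ z‖, sq_nonneg ‖c ⊙ z - c ⊙ (c ⊙ z)‖]
  simpa using this

theorem unit_mul (x : E) : unit ⊙ x = x := by rw [mul_comm, mul_unit]

theorem inner_mul_idem {d : E} (hd : d ⊙ d = d) (c : E) :
    inner ℝ (c ⊙ d) d = inner ℝ c d := by
  rw [← inner_mul, hd]

/-- Orthogonal idempotents annihilate each other. -/
theorem mul_eq_zero_of_inner_idem {c d : E} (hc : c ⊙ c = c) (hd : d ⊙ d = d)
    (h : inner ℝ c d = 0) : c ⊙ d = 0 :=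
  mul_eq_zero_of_inner_eq_zero hc (by rw [inner_mul_idem hd, h])

theorem inner_idem_nonneg {c d : E} (hc : c ⊙ c = c) (hd : d ⊙ d = d) : 0 ≤ inner ℝ c d := by
  rw [← inner_mul_idem hd]; exact inner_mul_self_nonneg hc d

theorem mul_eq_zero_of_idem_add {a b : E} (ha : a ⊙ a = a) (hb : b ⊙ b = b)
    (hab : (a + b) ⊙ (a + b) = a + b) : a ⊙ b = 0 := by
  simp only [map_add, LinearMap.add_apply, ha, hb, mul_comm b a] at hab
  have : (2 : ℝ) • (a ⊙ b) = 0 := by linear_combination (norm := module) hab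
  simpa using this

/-! ### Power associativity -/

/-- With `c` a power of `x`, this is the recursion that expresses `L(xⁿ⁺²)` through `L(xⁿ⁺¹)`,
`L(xⁿ)`, `L(x)` and `L(x²)`. -/
theorem mul_mul_mul_eq (x c : E) : mul (x ⊙ (x ⊙ c)) =
    (mul (x ⊙ x) * mul c + (2 : ℝ) • (mul (x ⊙ c) * mul x) - mul x * mul x * mul c
      - mul c * mul x * mul x : Module.End ℝ E) := by
  ext y
  have h1 := linearized_jordan x c y x
  simp only [LinearMap.sub_apply, LinearMap.add_apply, LinearMap.smul_apply,
    Module.End.mul_apply]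
  rw [mul_comm (c ⊙ y) x, mul_comm (y ⊙ x) x, mul_comm y x, mul_comm (x ⊙ c) x,
    mul_comm (c ⊙ y) (x ⊙ x), mul_comm (x ⊙ y) (c ⊙ x), mul_comm c x,
    mul_comm y (x ⊙ (x ⊙ c))] at h1
  linear_combination (norm := module) h1

/-- The `n`-th power of `x`. -/
def jpow (x : E) (n : ℕ) : E := ((mul x : Module.End ℝ E) ^ n) unit

theorem jpow_zero (x : E) : jpow x 0 = unit := rfl

theorem jpow_succ (x : E) (n : ℕ) : jpow x (n + 1) = x ⊙ jpow x n := by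
  simp [jpow, pow_succ']

/-- Two consecutive powers are carried through the induction because the recursion has two steps. -/
theorem commute_mul_jpow (x : E) (S : Module.End ℝ E) (h1 : Commute S (mul x))
    (h2 : Commute S (mul (x ⊙ x))) (n : ℕ) :
    Commute S (mul (jpow x n)) ∧ Commute S (mul (jpow x (n + 1))) := by
  induction n with
  | zero =>
    constructor
    · have : (mul (jpow x 0) : Module.End ℝ E) = 1 := by
        ext y; simp [jpow_zero, unit_mul]
      rw [this]; exact Commute.one_right S
    · rwa [jpow_succ, jpow_zero, mul_unit]
  | succ n ih =>
    refine ⟨ih.2, ?_⟩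
    rw [jpow_succ, jpow_succ, mul_mul_mul_eq, ← jpow_succ]
    exact (((h2.mul_right ih.1).add_right ((ih.2.mul_right h1).smul_right _)).sub_right
      ((h1.mul_right h1).mul_right ih.1)).sub_right ((ih.1.mul_right h1).mul_right h1)

theorem commute_mul_mul_jpow (x : E) (n : ℕ) :
    Commute (mul x : Module.End ℝ E) (mul (jpow x n)) := by
  refine (commute_mul_jpow x _ (Commute.refl _) ?_ n).1
  ext y
  exact jordan x y

theorem jpow_mul_jpow (x : E) (m n : ℕ) : jpow x m ⊙ jpow x n = jpow x (m + n) := by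
  induction m with
  | zero => rw [jpow_zero, unit_mul, Nat.zero_add]
  | succ m ih =>
    have h := congrArg (fun S : Module.End ℝ E => S (jpow x m)) (commute_mul_mul_jpow x n)
    simp only [Module.End.mul_apply] at h
    rw [jpow_succ, mul_comm, ← h, mul_comm (jpow x n), ih, ← jpow_succ]
    congr 1; omega

/-- The value of a polynomial at `x`. -/
noncomputable def jeval (x : E) (p : Polynomial ℝ) : E :=
  Polynomial.aeval (mul x : Module.End ℝ E) p unit

theorem jeval_mul (x : E) (p q : Polynomial ℝ) : jeval x p ⊙ jeval x q = jeval x (p * q) := by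
  induction p using Polynomial.induction_on' with
  | add p p' hp hp' =>
    have : jeval x (p + p') = jeval x p + jeval x p' := by simp [jeval]
    rw [this, map_add, LinearMap.add_apply, hp, hp', add_mul]; simp [jeval]
  | monomial m a =>
    induction q using Polynomial.induction_on' with
    | add q q' hq hq' =>
      have : jeval x (q + q') = jeval x q + jeval x q' := by simp [jeval]
      rw [this, map_add, hq, hq', mul_add]; simp [jeval]
    | monomial n b =>
      have key : ∀ (k : ℕ) (s : ℝ), jeval x (Polynomial.monomial k s) = s • jpow x k := by
        intro k s
        simp [jeval, jpow, Polynomial.aeval_monomial]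
      rw [Polynomial.monomial_mul_monomial, key, key, key, ← jpow_mul_jpow]
      simp [smul_smul, _root_.mul_comm]

end Identities

/-! ### Spectral decomposition -/

section Spectral

variable {E : Type*} [NormedAddCommGroup E] [InnerProductSpace ℝ E] [EuclideanJordanAlgebra E]

local infixl:70 " ⊙ " => EuclideanJordanAlgebra.mul

/-- A finite set of orthogonal idempotents with sum the unit. -/
structure IsOrthogonalSystem (S : Finset E) : Prop where
  idem : ∀ c ∈ S, IsIdem c
  orthogonal : ∀ c ∈ S, ∀ d ∈ S, c ≠ d → c ⊙ d = 0
  sum_eq_unit : ∑ c ∈ S, c = unit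

theorem inner_eq_zero_of_mul_eq_zero {x y : E} (h : x ⊙ y = 0) : inner ℝ x y = 0 := by
  rw [← mul_unit y, inner_mul, h, inner_zero_left]

theorem isSymmetric_mul (x : E) : (mul x : E →ₗ[ℝ] E).IsSymmetric :=
  fun a b => inner_mul_left x a b

/-- Since `L(x)` is symmetric, the unit splits into eigenvectors of `L(x)`. Each component is a
Lagrange polynomial evaluated at `x`, and multiplicativity of `jeval` turns the relations between
these polynomials into idempotency and orthogonality. -/
theorem exists_orthogonalSystem [FiniteDimensional ℝ E] (x : E) :
    ∃ S : Finset E, IsOrthogonalSystem S ∧ ∃ l : E → ℝ, x = ∑ c ∈ S, l c • c := by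
  classical
  have htop : (⨆ t, Module.End.eigenspace (mul x : Module.End ℝ E) t) = ⊤ := by
    rw [← Submodule.orthogonal_eq_bot_iff]
    exact (isSymmetric_mul x).orthogonalComplement_iSup_eigenspaces_eq_bot
  obtain ⟨ε, hε, hsum⟩ := (Submodule.mem_iSup_iff_exists_finsupp _ (unit : E)).1
    (htop ▸ Submodule.mem_top : (unit : E) ∈ ⨆ t, Module.End.eigenspace (mul x : Module.End ℝ E) t)
  replace hsum : ∑ t ∈ ε.support, ε t = unit := hsum
  have hx : ∀ t, x ⊙ ε t = t • ε t := fun t => Module.End.mem_eigenspace_iff.1 (hε t)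
  have hev : ∀ (p : Polynomial ℝ) (t : ℝ),
      Polynomial.aeval (mul x : Module.End ℝ E) p (ε t) = p.eval t • ε t := by
    intro p t
    by_cases h0 : ε t = 0
    · simp [h0]
    · exact Module.End.aeval_apply_of_hasEigenvector ⟨hε t, h0⟩
  have hval : ∀ p : Polynomial ℝ, jeval x p = ∑ t ∈ ε.support, p.eval t • ε t := by
    intro p
    rw [jeval, ← hsum, map_sum]
    exact Finset.sum_congr rfl fun t _ => hev p t
  let b : ℝ → Polynomial ℝ := Lagrange.basis ε.support id
  have hb : ∀ t ∈ ε.support, jeval x (b t) = ε t := by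
    intro t ht
    rw [hval, Finset.sum_eq_single t]
    · rw [show (b t).eval t = 1 from
        Lagrange.eval_basis_self (v := id) Function.injective_id.injOn ht, one_smul]
    · intro u hu hut
      rw [show (b t).eval u = 0 from Lagrange.eval_basis_of_ne (v := id) hut.symm hu, zero_smul]
    · intro h; exact absurd ht h
  have hmul : ∀ t ∈ ε.support, ∀ u ∈ ε.support, ε t ⊙ ε u = if t = u then ε u else 0 := by
    intro t ht u hu
    have : jeval x (b t * b u) = Polynomial.aeval (mul x : Module.End ℝ E) (b t) (ε u) := by
      rw [← hb u hu]
      simp [jeval, map_mul]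
    rw [← hb t ht, ← hb u hu, jeval_mul, this, hev, hb u hu]
    split_ifs with h
    · subst h
      rw [show (b t).eval t = 1 from
        Lagrange.eval_basis_self (v := id) Function.injective_id.injOn ht, one_smul]
    · rw [show (b t).eval u = 0 from Lagrange.eval_basis_of_ne (v := id) h hu, zero_smul]
  have hne : ∀ t ∈ ε.support, ε t ≠ 0 := fun t ht => Finsupp.mem_support_iff.1 ht
  have hinj : ∀ t ∈ ε.support, ∀ u ∈ ε.support, ε t = ε u → t = u := by
    intro t ht u hu htu
    by_contra h
    have := hmul t ht u hu
    rw [if_neg h, htu, hmul u hu u hu, if_pos rfl] at this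
    exact hne u hu this
  -- The coefficients are indexed by the idempotents, so the eigenvalue is recovered as a Rayleigh
  -- quotient.
  refine ⟨ε.support.image ε, ⟨?_, ?_, ?_⟩, fun c => (inner ℝ (x ⊙ c) c) / (inner ℝ c c), ?_⟩
  · intro c hc
    obtain ⟨t, ht, rfl⟩ := Finset.mem_image.1 hc
    exact ⟨by rw [hmul t ht t ht, if_pos rfl], hne t ht⟩
  · intro c hc d hd hcd
    obtain ⟨t, ht, rfl⟩ := Finset.mem_image.1 hc
    obtain ⟨u, hu, rfl⟩ := Finset.mem_image.1 hd
    rw [hmul t ht u hu, if_neg]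
    rintro rfl; exact hcd rfl
  · rw [Finset.sum_image hinj, hsum]
  · rw [Finset.sum_image hinj]
    conv_lhs => rw [← mul_unit x, ← hsum, map_sum]
    refine Finset.sum_congr rfl fun t ht => ?_
    simp only [hx]
    rw [real_inner_smul_left, mul_div_cancel_right₀]
    exact inner_self_ne_zero.2 (hne t ht)

theorem IsOrthogonalSystem.card_le [FiniteDimensional ℝ E] {S : Finset E}
    (hS : IsOrthogonalSystem S) : S.card ≤ Module.finrank ℝ E := by
  have : LinearIndependent ℝ (fun c : S => (c : E)) := by
    refine linearIndependent_of_ne_zero_of_inner_eq_zero (fun c => (hS.idem c c.2).2) ?_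
    intro c d hcd
    exact inner_eq_zero_of_mul_eq_zero
      (hS.orthogonal c c.2 d d.2 fun h => hcd (Subtype.ext h))
  simpa using this.fintype_card_le_finrank

/-- If an idempotent is orthogonal to a sum of idempotents, it is orthogonal to the summands. -/
theorem mul_eq_zero_of_mul_add_eq_zero {a b d : E} (ha : a ⊙ a = a) (hb : b ⊙ b = b)
    (hd : d ⊙ d = d) (h : (a + b) ⊙ d = 0) : a ⊙ d = 0 := by
  have h0 := inner_eq_zero_of_mul_eq_zero h
  rw [inner_add_left] at h0
  have h1 := inner_idem_nonneg ha hd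
  have h2 := inner_idem_nonneg hb hd
  exact mul_eq_zero_of_inner_idem ha hd (by linarith)

/-- A non-primitive `c = a + b` can be replaced by `a` and `b`, with the same coefficient:
positivity of idempotents makes both parts annihilate everything that `c` annihilates in the system.
-/
theorem IsOrthogonalSystem.refine {S : Finset E} (hS : IsOrthogonalSystem S) {c : E}
    (hc : c ∈ S) (hprim : ¬ IsPrimitive c) {x : E} {l : E → ℝ} (hx : x = ∑ c ∈ S, l c • c) :
    ∃ S' : Finset E, IsOrthogonalSystem S' ∧ S'.card = S.card + 1 ∧
      ∃ l' : E → ℝ, x = ∑ c ∈ S', l' c • c := by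
  classical
  have hidem := hS.idem c hc
  obtain ⟨a, b, ha, hb, hab⟩ : ∃ a b : E, IsIdem a ∧ IsIdem b ∧ c = a + b := by
    by_contra h; exact hprim ⟨hidem, h⟩
  have hmab : a ⊙ b = 0 := mul_eq_zero_of_idem_add ha.1 hb.1 (by rw [← hab]; exact hidem.1)
  have key : ∀ d ∈ S.erase c, a ⊙ d = 0 ∧ b ⊙ d = 0 := by
    intro d hd
    have hd' := Finset.mem_erase.1 hd
    have hdd := hS.idem d hd'.2
    have h0 := hS.orthogonal c hc d hd'.2 hd'.1.symm
    rw [hab] at h0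
    refine ⟨mul_eq_zero_of_mul_add_eq_zero ha.1 hb.1 hdd.1 h0, ?_⟩
    rw [add_comm] at h0
    exact mul_eq_zero_of_mul_add_eq_zero hb.1 ha.1 hdd.1 h0
  have hab' : a ≠ b := by
    rintro rfl; rw [ha.1] at hmab; exact ha.2 hmab
  have haS : a ∉ S.erase c := by
    intro h; have := (key a h).1; rw [ha.1] at this; exact ha.2 this
  have hbS : b ∉ S.erase c := by
    intro h; have := (key b h).2; rw [hb.1] at this; exact hb.2 this
  have haS' : a ∉ insert b (S.erase c) := by
    simp only [Finset.mem_insert, not_or]; exact ⟨hab', haS⟩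
  refine ⟨insert a (insert b (S.erase c)), ⟨?_, ?_, ?_⟩, ?_, ?_⟩
  · intro d hd
    simp only [Finset.mem_insert] at hd
    rcases hd with rfl | rfl | hd
    · exact ha
    · exact hb
    · exact hS.idem d (Finset.mem_of_mem_erase hd)
  · intro d hd f hf hdf
    simp only [Finset.mem_insert] at hd hf
    rcases hd with rfl | rfl | hd <;> rcases hf with rfl | rfl | hf
    · exact absurd rfl hdf
    · exact hmab
    · exact (key f hf).1
    · rw [mul_comm]; exact hmab
    · exact absurd rfl hdf
    · exact (key f hf).2
    · rw [mul_comm]; exact (key d hd).1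
    · rw [mul_comm]; exact (key d hd).2
    · exact hS.orthogonal d (Finset.mem_of_mem_erase hd) f (Finset.mem_of_mem_erase hf) hdf
  · rw [Finset.sum_insert haS', Finset.sum_insert hbS, ← add_assoc, ← hab,
      Finset.add_sum_erase S (fun c => c) hc, hS.sum_eq_unit]
  · rw [Finset.card_insert_of_notMem haS', Finset.card_insert_of_notMem hbS,
      Finset.card_erase_add_one hc]
  · refine ⟨fun d => if d = a ∨ d = b then l c else l d, ?_⟩
    rw [Finset.sum_insert haS', Finset.sum_insert hbS, hx, ← Finset.add_sum_erase S _ hc]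
    simp only [true_or, or_true, if_true]
    rw [← add_assoc, ← smul_add, ← hab]
    congr 1
    refine Finset.sum_congr rfl fun d hd => ?_
    rw [if_neg]
    rintro (rfl | rfl)
    · exact haS hd
    · exact hbS hd

/-- The spectral theorem. -/
theorem exists_spectral [FiniteDimensional ℝ E] (x : E) :
    ∃ (r : ℕ) (c : Fin r → E) (l : Fin r → ℝ), IsCompleteSystem c ∧ x = ∑ i, l i • c i := by
  classical
  -- An orthogonal system of maximal cardinality cannot be refined, so its members are primitive;
  -- linear independence bounds the cardinality.
  let P : ℕ → Prop := fun n => ∃ S : Finset E, IsOrthogonalSystem S ∧ S.card = n ∧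
    ∃ l : E → ℝ, x = ∑ c ∈ S, l c • c
  have hP : ∃ n, P n := by
    obtain ⟨S, hS, l, hl⟩ := exists_orthogonalSystem x
    exact ⟨S.card, S, hS, rfl, l, hl⟩
  have hbd : ∀ n, P n → n ≤ Module.finrank ℝ E := by
    rintro n ⟨S, hS, rfl, -⟩; exact hS.card_le
  obtain ⟨n, hn⟩ := hP
  have hmax := Nat.findGreatest_spec (P := P) (hbd n hn) hn
  set m := Nat.findGreatest P (Module.finrank ℝ E) with hm
  obtain ⟨S, hS, hcard, l, hl⟩ := hmax
  have hprim : ∀ c ∈ S, IsPrimitive c := by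
    intro c hc
    by_contra h
    obtain ⟨S', hS', hcard', h'⟩ := hS.refine hc h hl
    have h1 : P (m + 1) := ⟨S', hS', by rw [hcard', hcard], h'⟩
    have := Nat.le_findGreatest (hbd _ h1) h1
    omega
  let ι := S.equivFin.symm
  refine ⟨S.card, fun i => (ι i : E), fun i => l (ι i), ⟨fun i => hprim _ (ι i).2, ?_, ?_⟩, ?_⟩
  · intro i j hij
    exact hS.orthogonal _ (ι i).2 _ (ι j).2 fun h => hij (ι.injective (Subtype.ext h))
  · rw [ι.sum_comp (fun c : S => (c : E)), Finset.sum_coe_sort S (fun c => c), hS.sum_eq_unit]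
  · rw [ι.sum_comp (fun c : S => l c • (c : E)), Finset.sum_coe_sort S (fun c => l c • c), hl]

end Spectral

/-! ### The cone of squares and its interior -/

section Cone

variable {E : Type*} [NormedAddCommGroup E] [InnerProductSpace ℝ E] [EuclideanJordanAlgebra E]

local infixl:70 " ⊙ " => EuclideanJordanAlgebra.mul

theorem IsCompleteSystem.idem {r : ℕ} {c : Fin r → E} (hc : IsCompleteSystem c) (i : Fin r) :
    c i ⊙ c i = c i := (hc.primitive i).1.1

theorem IsCompleteSystem.ne_zero {r : ℕ} {c : Fin r → E} (hc : IsCompleteSystem c) (i : Fin r) :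
    c i ≠ 0 := (hc.primitive i).1.2

theorem IsCompleteSystem.mul_sum {r : ℕ} {c : Fin r → E} (hc : IsCompleteSystem c)
    (i : Fin r) (b : Fin r → ℝ) : c i ⊙ (∑ j, b j • c j) = b i • c i := by
  rw [map_sum, Finset.sum_eq_single i]
  · rw [map_smul, hc.idem]
  · intro j _ hj; rw [map_smul, hc.orthogonal i j hj.symm, smul_zero]
  · simp

theorem IsCompleteSystem.sum_mul_sum {r : ℕ} {c : Fin r → E} (hc : IsCompleteSystem c)
    (a b : Fin r → ℝ) :
    (∑ i, a i • c i) ⊙ (∑ j, b j • c j) = ∑ i, (a i * b i) • c i := by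
  rw [map_sum mul, LinearMap.sum_apply]
  refine Finset.sum_congr rfl fun i _ => ?_
  rw [map_smul mul, LinearMap.smul_apply, hc.mul_sum, smul_smul]

theorem IsCompleteSystem.inner_sum {r : ℕ} {c : Fin r → E} (hc : IsCompleteSystem c)
    (i : Fin r) (b : Fin r → ℝ) : inner ℝ (∑ j, b j • c j) (c i) = b i * inner ℝ (c i) (c i) := by
  rw [← hc.idem i, inner_mul, mul_comm, hc.mul_sum, real_inner_smul_left, hc.idem]

theorem IsCompleteSystem.inner_self_pos {r : ℕ} {c : Fin r → E} (hc : IsCompleteSystem c)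
    (i : Fin r) : 0 < inner ℝ (c i) (c i) :=
  real_inner_self_pos.2 (hc.ne_zero i)

theorem IsCompleteSystem.smul_unit {r : ℕ} {c : Fin r → E} (hc : IsCompleteSystem c) (t : ℝ) :
    t • (unit : E) = ∑ i, t • c i := by
  rw [← hc.sum_eq_unit, Finset.smul_sum]

variable (E) in
/-- The closed cone of squares. -/
def squares : Set E := {z : E | ∃ x : E, z = x ⊙ x}

theorem sum_mem_squares {r : ℕ} {c : Fin r → E} (hc : IsCompleteSystem c)
    {l : Fin r → ℝ} (hl : ∀ i, 0 ≤ l i) : ∑ i, l i • c i ∈ squares E := by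
  refine ⟨∑ i, √(l i) • c i, ?_⟩
  rw [hc.sum_mul_sum]
  exact Finset.sum_congr rfl fun i _ => by rw [Real.mul_self_sqrt (hl i)]

theorem idem_mem_squares {c : E} (hc : c ⊙ c = c) : c ∈ squares E := ⟨c, hc.symm⟩

theorem smul_mem_squares {x : E} (hx : x ∈ squares E) {t : ℝ} (ht : 0 ≤ t) :
    t • x ∈ squares E := by
  obtain ⟨y, rfl⟩ := hx
  refine ⟨√t • y, ?_⟩
  rw [map_smul mul, LinearMap.smul_apply, map_smul, smul_smul, Real.mul_self_sqrt ht]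

theorem eq_zero_of_mem_squares_of_inner_unit {z : E} (hz : z ∈ squares E)
    (h : inner ℝ z unit ≤ 0) : z = 0 := by
  obtain ⟨x, rfl⟩ := hz
  rw [← inner_mul, mul_unit] at h
  have : x = 0 := by
    rw [← inner_self_eq_zero (𝕜 := ℝ)]
    exact le_antisymm h real_inner_self_nonneg
  simp [this]

theorem isOpen_cone : IsOpen (cone E) := isOpen_interior

theorem cone_subset_squares : cone E ⊆ squares E := interior_subset

variable [FiniteDimensional ℝ E]

theorem inner_mul_nonneg {z : E} (hz : z ∈ squares E) (x : E) : 0 ≤ inner ℝ (z ⊙ x) x := by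
  obtain ⟨y, rfl⟩ := hz
  obtain ⟨r, c, l, hc, rfl⟩ := exists_spectral y
  rw [hc.sum_mul_sum, map_sum, LinearMap.sum_apply, sum_inner]
  refine Finset.sum_nonneg fun i _ => ?_
  rw [map_smul, LinearMap.smul_apply, real_inner_smul_left]
  exact mul_nonneg (mul_self_nonneg _) (inner_mul_self_nonneg (hc.idem i) x)

theorem inner_squares_nonneg {z y : E} (hz : z ∈ squares E) (hy : y ∈ squares E) :
    0 ≤ inner ℝ z y := by
  obtain ⟨x, rfl⟩ := hy
  rw [inner_mul]
  exact inner_mul_nonneg hz x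

theorem sum_mem_squares_iff {r : ℕ} {c : Fin r → E} (hc : IsCompleteSystem c)
    {l : Fin r → ℝ} : ∑ i, l i • c i ∈ squares E ↔ ∀ i, 0 ≤ l i := by
  refine ⟨fun h i => ?_, sum_mem_squares hc⟩
  have := inner_squares_nonneg h (idem_mem_squares (hc.idem i))
  rw [hc.inner_sum] at this
  exact nonneg_of_mul_nonneg_left this (hc.inner_self_pos i)

/-- Self-duality: pairing with the idempotents of a spectral decomposition already detects a
negative eigenvalue. Closedness and convexity of the cone follow. -/
theorem mem_squares_iff_inner {z : E} : z ∈ squares E ↔ ∀ y ∈ squares E, 0 ≤ inner ℝ z y := by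
  refine ⟨fun hz y hy => inner_squares_nonneg hz hy, fun h => ?_⟩
  obtain ⟨r, c, l, hc, rfl⟩ := exists_spectral z
  refine sum_mem_squares hc fun i => ?_
  have := h _ (idem_mem_squares (hc.idem i))
  rw [hc.inner_sum] at this
  exact nonneg_of_mul_nonneg_left this (hc.inner_self_pos i)

theorem isClosed_squares : IsClosed (squares E) := by
  have : squares E = ⋂ y ∈ squares E, {z : E | 0 ≤ inner ℝ z y} := by
    ext z; simp only [Set.mem_iInter]; exact mem_squares_iff_inner
  rw [this]
  exact isClosed_biInter fun y _ => isClosed_le continuous_const (by fun_prop)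

theorem add_mem_squares {x y : E} (hx : x ∈ squares E) (hy : y ∈ squares E) :
    x + y ∈ squares E := by
  rw [mem_squares_iff_inner]
  intro z hz
  rw [inner_add_left]
  exact add_nonneg (inner_squares_nonneg hx hz) (inner_squares_nonneg hy hz)

/-- The decomposition of an element into positive and negative part. -/
theorem exists_moreau (z : E) : ∃ p s : E, z = p - s ⊙ s ∧ p ∈ squares E ∧ p ⊙ s = 0 ∧
    p ⊙ (s ⊙ s) = 0 := by
  obtain ⟨r, c, l, hc, rfl⟩ := exists_spectral z
  have h0 : ∀ i, max (l i) 0 * √(max (-l i) 0) = 0 := by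
    intro i
    rcases le_total (l i) 0 with h | h
    · rw [max_eq_right h, zero_mul]
    · rw [max_eq_right (neg_nonpos.2 h), Real.sqrt_zero, mul_zero]
  refine ⟨∑ i, max (l i) 0 • c i, ∑ i, √(max (-l i) 0) • c i, ?_,
    sum_mem_squares hc fun i => le_max_right _ _, ?_, ?_⟩
  · rw [hc.sum_mul_sum, ← Finset.sum_sub_distrib]
    refine Finset.sum_congr rfl fun i _ => ?_
    rw [← sub_smul, Real.mul_self_sqrt (le_max_right _ _)]
    congr 1
    rcases le_total (l i) 0 with h | h
    · rw [max_eq_right h, max_eq_left (neg_nonneg.2 h)]; ring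
    · rw [max_eq_right (neg_nonpos.2 h), max_eq_left h]; ring
  · rw [hc.sum_mul_sum]
    exact Finset.sum_eq_zero fun i _ => by rw [h0, zero_smul]
  · rw [hc.sum_mul_sum, hc.sum_mul_sum]
    exact Finset.sum_eq_zero fun i _ => by rw [← _root_.mul_assoc, h0, zero_mul, zero_smul]

theorem exists_ball_subset_squares : ∃ ε > 0, ∀ v : E, ‖v‖ < ε → unit + v ∈ squares E := by
  obtain ⟨M, hM0, hM⟩ : ∃ M > 0, ∀ v y : E, ‖v ⊙ y‖ ≤ M * ‖v‖ * ‖y‖ := by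
    let B : E →L[ℝ] E →L[ℝ] E :=
      LinearMap.toContinuousLinearMap
        ((LinearMap.toContinuousLinearMap : (E →ₗ[ℝ] E) ≃ₗ[ℝ] (E →L[ℝ] E)).toLinearMap ∘ₗ mul)
    refine ⟨‖B‖ + 1, by positivity, fun v y => ?_⟩
    have := B.le_opNorm₂ v y
    refine le_trans this ?_
    gcongr
    linarith
  refine ⟨1 / M, by positivity, fun v hv => ?_⟩
  obtain ⟨r, c, l, hc, rfl⟩ := exists_spectral v
  rw [← hc.sum_eq_unit, ← Finset.sum_add_distrib]
  have : ∀ i, c i + l i • c i = (1 + l i) • c i := fun i => by rw [add_smul, one_smul]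
  simp only [this]
  refine sum_mem_squares hc fun i => ?_
  -- Each eigenvalue of `v` is an eigenvalue of `L(v)`, hence at most `M‖v‖ < 1` in absolute value.
  have h1 := hM (∑ i, l i • c i) (c i)
  rw [mul_comm, hc.mul_sum, norm_smul] at h1
  have h2 : |l i| ≤ M * ‖∑ i, l i • c i‖ :=
    le_of_mul_le_mul_right h1 (norm_pos_iff.2 (hc.ne_zero i))
  have h3 : M * ‖∑ i, l i • c i‖ < 1 := by
    rw [lt_div_iff₀ hM0] at hv; linarith
  have := neg_abs_le (l i)
  linarith

theorem unit_mem_cone : (unit : E) ∈ cone E := by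
  obtain ⟨ε, hε, h⟩ := exists_ball_subset_squares (E := E)
  rw [cone, mem_interior_iff_mem_nhds, Metric.mem_nhds_iff]
  refine ⟨ε, hε, fun y hy => ?_⟩
  have := h (y - unit) (by rwa [← dist_eq_norm])
  rwa [add_sub_cancel] at this

theorem smul_mem_cone {x : E} (hx : x ∈ cone E) {t : ℝ} (ht : 0 < t) : t • x ∈ cone E := by
  obtain ⟨U, hU, hUo, hxU⟩ := mem_interior.1 (show x ∈ interior (squares E) from hx)
  change _ ∈ interior (squares E)
  rw [mem_interior]
  refine ⟨(fun z => t • z) '' U, ?_, (Homeomorph.smulOfNeZero t ht.ne').isOpenMap U hUo,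
    ⟨x, hxU, rfl⟩⟩
  rintro _ ⟨y, hy, rfl⟩
  exact smul_mem_squares (hU hy) ht.le

theorem add_mem_cone {x y : E} (hx : x ∈ cone E) (hy : y ∈ squares E) : x + y ∈ cone E := by
  obtain ⟨U, hU, hUo, hxU⟩ := mem_interior.1 (show x ∈ interior (squares E) from hx)
  change _ ∈ interior (squares E)
  rw [mem_interior]
  refine ⟨(fun z => z + y) '' U, ?_, (Homeomorph.addRight y).isOpenMap U hUo, ⟨x, hxU, rfl⟩⟩
  rintro _ ⟨z, hz, rfl⟩
  exact add_mem_squares (hU hz) hy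

theorem sum_mem_cone_iff {r : ℕ} {c : Fin r → E} (hc : IsCompleteSystem c)
    {l : Fin r → ℝ} : ∑ i, l i • c i ∈ cone E ↔ ∀ i, 0 < l i := by
  constructor
  · intro h i
    have hcont : Tendsto (fun ε : ℝ => (∑ i, l i • c i) - ε • (unit : E)) (𝓝[>] 0)
        (𝓝 (∑ i, l i • c i)) := by
      have : Continuous (fun ε : ℝ => (∑ i, l i • c i) - ε • (unit : E)) := by fun_prop
      have := this.tendsto 0
      rw [zero_smul, sub_zero] at this
      exact this.mono_left nhdsWithin_le_nhds
    have h1 := hcont.eventually (isOpen_cone.mem_nhds h)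
    obtain ⟨ε, hε, hε0⟩ := (h1.and self_mem_nhdsWithin).exists
    have h2 := cone_subset_squares hε
    rw [hc.smul_unit, ← Finset.sum_sub_distrib] at h2
    simp only [← sub_smul] at h2
    have h3 := (sum_mem_squares_iff hc).1 h2 i
    have h4 : 0 < ε := hε0
    linarith
  · intro h
    obtain ⟨m, hm, hml⟩ : ∃ m > 0, ∀ i, m ≤ l i := by
      rcases isEmpty_or_nonempty (Fin r) with h0 | h0
      · exact ⟨1, one_pos, fun i => h0.elim i⟩
      · obtain ⟨j, hj⟩ := Finite.exists_min l
        exact ⟨l j, h j, hj⟩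
    have : ∑ i, l i • c i = m • unit + ∑ i, (l i - m) • c i := by
      rw [hc.smul_unit, ← Finset.sum_add_distrib]
      exact Finset.sum_congr rfl fun i _ => by rw [← add_smul]; congr 1; ring
    rw [this]
    exact add_mem_cone (smul_mem_cone unit_mem_cone hm)
      (sum_mem_squares hc fun i => by linarith [hml i])

theorem closure_cone : closure (cone E) = squares E := by
  apply subset_antisymm
  · exact closure_minimal cone_subset_squares isClosed_squares
  · intro z hz
    have hcont : Tendsto (fun ε : ℝ => z + ε • (unit : E)) (𝓝[>] 0) (𝓝 z) := by
      have : Continuous (fun ε : ℝ => z + ε • (unit : E)) := by fun_prop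
      have := this.tendsto 0
      rw [zero_smul, add_zero] at this
      exact this.mono_left nhdsWithin_le_nhds
    refine mem_closure_of_tendsto hcont ?_
    filter_upwards [self_mem_nhdsWithin] with ε hε
    rw [add_comm]
    exact add_mem_cone (smul_mem_cone unit_mem_cone hε) hz

end Cone

/-! ### One-parameter groups of cone automorphisms -/

section Exponential

variable {E : Type*} [NormedAddCommGroup E] [InnerProductSpace ℝ E] [EuclideanJordanAlgebra E]

local infixl:70 " ⊙ " => EuclideanJordanAlgebra.mul

/-- `A` is tangent to the boundary of the cone of squares. -/
def IsTangent (A : E →L[ℝ] E) : Prop :=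
  ∀ p s : E, p ⊙ s = 0 → p ⊙ (s ⊙ s) = 0 → inner ℝ (A p) (s ⊙ s) = 0

theorem IsTangent.smul {A : E →L[ℝ] E} (hA : IsTangent A) (t : ℝ) : IsTangent (t • A) := by
  intro p s h1 h2
  rw [smul_apply, real_inner_smul_left, hA p s h1 h2, mul_zero]

variable [FiniteDimensional ℝ E]

/-- The multiplication operator as a continuous linear map. -/
noncomputable def mulL (v : E) : E →L[ℝ] E := LinearMap.toContinuousLinearMap (mul v)

theorem mulL_apply (v x : E) : mulL v x = v ⊙ x := rfl

theorem isTangent_mulL (v : E) : IsTangent (mulL v) := by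
  intro p s _ h
  rw [mulL_apply, ← inner_mul, h, inner_zero_right]

/-- The derivation `[L(a), L(b)]`. -/
noncomputable def commutatorL (a b : E) : E →L[ℝ] E := mulL a * mulL b - mulL b * mulL a

theorem commutatorL_apply (a b x : E) : commutatorL a b x = a ⊙ (b ⊙ x) - b ⊙ (a ⊙ x) := rfl

/-- A derivation `A` applied to `ps = 0` gives `(Ap)s = -p(As)`, so `⟨Ap, s²⟩ = -⟨As, ps⟩ = 0`. This
is where the condition `p ⊙ s = 0` in `IsTangent` is needed; multiplications use `p ⊙ s² = 0`. -/
theorem isTangent_commutatorL (a b : E) : IsTangent (commutatorL a b) := by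
  intro p s h _
  have h1 := commutator_derivation a b p s
  rw [h] at h1
  simp only [map_zero, sub_zero] at h1
  rw [commutatorL_apply, inner_mul, eq_neg_of_add_eq_zero_left h1.symm, inner_neg_left,
    inner_mul_left, h, inner_zero_right, neg_zero]

theorem commutatorL_unit (a b : E) : commutatorL a b unit = 0 := by
  rw [commutatorL_apply, mul_unit, mul_unit, mul_comm a b, sub_self]

theorem commutatorL_skew (a b x y : E) :
    inner ℝ (commutatorL a b x) y = - inner ℝ x (commutatorL a b y) := by
  rw [commutatorL_apply, commutatorL_apply, inner_sub_left, inner_sub_right, inner_mul_left,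
    inner_mul_left, inner_mul_left, inner_mul_left]
  ring

/-- By self-duality `p` is the nearest point of the cone to `p - s²`, as in Moreau's decomposition.
-/
theorem infDist_squares {p s : E} (hp : p ∈ squares E) (h : p ⊙ (s ⊙ s) = 0) :
    Metric.infDist (p - s ⊙ s) (squares E) = ‖s ⊙ s‖ := by
  apply le_antisymm
  · have := Metric.infDist_le_dist_of_mem (x := p - s ⊙ s) hp
    rwa [dist_eq_norm, sub_sub_cancel_left, norm_neg] at this
  · refine (Metric.le_infDist ⟨p, hp⟩).2 fun y hy => ?_
    rw [dist_eq_norm]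
    have h1 : 0 ≤ inner ℝ y (s ⊙ s) := inner_squares_nonneg hy ⟨s, rfl⟩
    have h2 : inner ℝ p (s ⊙ s) = 0 := inner_eq_zero_of_mul_eq_zero h
    have h3 : ‖p - s ⊙ s - y‖ ^ 2 = ‖p - y‖ ^ 2 + ‖s ⊙ s‖ ^ 2 + 2 * inner ℝ y (s ⊙ s) := by
      rw [sub_right_comm, norm_sub_sq_real, inner_sub_left, h2]; ring
    have : ‖s ⊙ s‖ ^ 2 ≤ ‖p - s ⊙ s - y‖ ^ 2 := by rw [h3]; nlinarith [sq_nonneg ‖p - y‖]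
    exact (sq_le_sq₀ (norm_nonneg _) (norm_nonneg _)).1 this

theorem hasDerivAt_exp_apply (A : E →L[ℝ] E) (x : E) (t : ℝ) :
    HasDerivAt (fun u : ℝ => NormedSpace.exp (u • A) x) (A (NormedSpace.exp (t • A) x)) t := by
  have := FiniteDimensional.complete ℝ E
  exact (hasDerivAt_exp_smul_const' A t).clm_apply (hasDerivAt_const t x) |>.congr_deriv (by simp)

theorem continuous_exp_apply (A : E →L[ℝ] E) (x : E) :
    Continuous (fun u : ℝ => NormedSpace.exp (u • A) x) :=
  continuous_iff_continuousAt.2 fun t => (hasDerivAt_exp_apply A x t).continuousAt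

/-- The flow of a linear vector field tangent to the cone preserves the cone. -/
theorem IsTangent.exp_mem_squares {A : E →L[ℝ] E} (hA : IsTangent A) {x : E}
    (hx : x ∈ squares E) : NormedSpace.exp A x ∈ squares E := by
  let z : ℝ → E := fun u => NormedSpace.exp (u • A) x
  let ψ : ℝ → ℝ := fun u => Metric.infDist (z u) (squares E) ^ 2
  have hz : Continuous z := continuous_exp_apply A x
  have hψ : Continuous ψ := ((Metric.continuous_infDist_pt _).comp hz).pow 2
  have hz0 : z 0 = x := by simp [z]
  -- The squared distance to the cone starts at zero and grows at most linearly in itself, so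
  -- Grönwall keeps it at zero.
  have key := le_gronwallBound_of_liminf_deriv_right_le (f := ψ) (f' := fun u => 2 * ‖A‖ * ψ u)
    (δ := 0) (K := 2 * ‖A‖) (ε := 0) (a := 0) (b := 1) hψ.continuousOn ?_ ?_ ?_ 1
    ⟨zero_le_one, le_rfl⟩
  · rw [gronwallBound_ε0_δ0] at key
    have h1 : Metric.infDist (z 1) (squares E) = 0 :=
      pow_eq_zero_iff two_ne_zero |>.1 (le_antisymm key (sq_nonneg _))
    have h2 := (isClosed_squares.mem_iff_infDist_zero ⟨x, hx⟩).2 h1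
    simpa [z] using h2
  · intro t _ r hr
    obtain ⟨p, s, hps, hp, h1, h2⟩ := exists_moreau (z t)
    have hψt : ψ t = ‖s ⊙ s‖ ^ 2 := by simp only [ψ]; rw [hps, infDist_squares hp h2]
    -- The distance need not be differentiable. Freezing the nearest point `p` at time `t` gives a
    -- smooth majorant of `ψ` that touches it at `t`, and tangency removes the term `⟨Ap, s²⟩` from
    -- its derivative.
    let φ : ℝ → ℝ := fun u => ‖z u - p‖ ^ 2
    have hφ : HasDerivAt φ (2 * inner ℝ (z t - p) (A (z t))) t :=
      ((hasDerivAt_exp_apply A x t).sub_const p).norm_sq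
    have hval : 2 * inner ℝ (z t - p) (A (z t)) ≤ 2 * ‖A‖ * ψ t := by
      have e1 : z t - p = - (s ⊙ s) := by rw [hps]; abel
      have e2 : inner ℝ (s ⊙ s) (A p) = 0 := by rw [real_inner_comm]; exact hA p s h1 h2
      rw [e1, hps, map_sub, inner_neg_left, inner_sub_right, e2, hψt]
      have e3 : inner ℝ (s ⊙ s) (A (s ⊙ s)) ≤ ‖s ⊙ s‖ * (‖A‖ * ‖s ⊙ s‖) :=
        (real_inner_le_norm _ _).trans (by gcongr; exact A.le_opNorm _)
      nlinarith
    have hslope := hasDerivAt_iff_tendsto_slope.1 hφ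
    have hev := (hslope.eventually (gt_mem_nhds (hval.trans_lt hr))).filter_mono
      (nhdsWithin_mono t (show Set.Ioi t ⊆ {t}ᶜ from fun u hu => ne_of_gt hu))
    refine Eventually.frequently ?_
    filter_upwards [hev, self_mem_nhdsWithin] with u hu hut
    refine lt_of_le_of_lt ?_ hu
    rw [slope_def_field, div_eq_inv_mul]
    have : 0 < u - t := sub_pos.2 hut
    have h3 : φ t = ψ t := by
      rw [hψt]; simp only [φ]; rw [hps, sub_sub_cancel_left, norm_neg]
    have h4 : ψ u ≤ φ u := by
      simp only [ψ, φ]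
      gcongr
      · exact Metric.infDist_nonneg
      · rw [← dist_eq_norm]; exact Metric.infDist_le_dist_of_mem hp
    rw [h3]
    gcongr
  · simp only [ψ]
    rw [hz0, Metric.infDist_zero_of_mem hx]; simp
  · intro t _; simp

/-- The exponential as an invertible operator. -/
noncomputable def expUnit (A : E →L[ℝ] E) : (E →L[ℝ] E)ˣ where
  val := NormedSpace.exp A
  inv := NormedSpace.exp (-A)
  val_inv := by
    have := FiniteDimensional.complete ℝ E
    let : NormedAlgebra ℚ (E →L[ℝ] E) := NormedAlgebra.restrictScalars ℚ ℝ _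
    rw [← NormedSpace.exp_add_of_commute (Commute.neg_right (Commute.refl A)), add_neg_cancel,
      NormedSpace.exp_zero]
  inv_val := by
    have := FiniteDimensional.complete ℝ E
    let : NormedAlgebra ℚ (E →L[ℝ] E) := NormedAlgebra.restrictScalars ℚ ℝ _
    rw [← NormedSpace.exp_add_of_commute (Commute.neg_left (Commute.refl A)), neg_add_cancel,
      NormedSpace.exp_zero]

theorem expUnit_val (A : E →L[ℝ] E) : (expUnit A : E →L[ℝ] E) = NormedSpace.exp A := rfl

theorem mem_coneAut_iff {g : (E →L[ℝ] E)ˣ} :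
    g ∈ coneAut E ↔ (g : E →L[ℝ] E) '' cone E = cone E := Iff.rfl

theorem units_inv_apply (g : (E →L[ℝ] E)ˣ) (x : E) :
    ((g⁻¹ : (E →L[ℝ] E)ˣ) : E →L[ℝ] E) ((g : E →L[ℝ] E) x) = x :=
  congrArg (fun T : E →L[ℝ] E => T x) g.inv_mul

theorem units_apply_inv (g : (E →L[ℝ] E)ˣ) (x : E) :
    (g : E →L[ℝ] E) (((g⁻¹ : (E →L[ℝ] E)ˣ) : E →L[ℝ] E) x) = x :=
  congrArg (fun T : E →L[ℝ] E => T x) g.mul_inv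

/-- An invertible operator as a homeomorphism. -/
def unitsHomeomorph (g : (E →L[ℝ] E)ˣ) : E ≃ₜ E where
  toFun := (g : E →L[ℝ] E)
  invFun := ((g⁻¹ : (E →L[ℝ] E)ˣ) : E →L[ℝ] E)
  left_inv := units_inv_apply g
  right_inv := units_apply_inv g
  continuous_toFun := (g : E →L[ℝ] E).continuous
  continuous_invFun := ((g⁻¹ : (E →L[ℝ] E)ˣ) : E →L[ℝ] E).continuous

theorem image_squares_of_mem_coneAut {g : (E →L[ℝ] E)ˣ} (hg : g ∈ coneAut E) :
    (g : E →L[ℝ] E) '' squares E = squares E := by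
  rw [← closure_cone]
  exact ((unitsHomeomorph g).image_closure (cone E)).trans
    (congrArg closure (mem_coneAut_iff.1 hg))

theorem mem_coneAut_of_image_squares {g : (E →L[ℝ] E)ˣ}
    (hg : (g : E →L[ℝ] E) '' squares E = squares E) : g ∈ coneAut E :=
  ((unitsHomeomorph g).image_interior (squares E)).trans (congrArg interior hg)

theorem IsTangent.expUnit_mem_coneAut {A : E →L[ℝ] E} (hA : IsTangent A) :
    expUnit A ∈ coneAut E := by
  apply mem_coneAut_of_image_squares
  apply subset_antisymm
  · rintro _ ⟨x, hx, rfl⟩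
    exact hA.exp_mem_squares hx
  · intro x hx
    refine ⟨NormedSpace.exp (-A) x, ?_, units_apply_inv (expUnit A) x⟩
    have : IsTangent (-A) := by simpa using hA.smul (-1)
    exact this.exp_mem_squares hx

theorem IsTangent.expUnit_mem_G {A : E →L[ℝ] E} (hA : IsTangent A) : expUnit A ∈ G E := by
  have := FiniteDimensional.complete ℝ E
  let : NormedAlgebra ℚ (E →L[ℝ] E) := NormedAlgebra.restrictScalars ℚ ℝ _
  let γ : ℝ → coneAut E := fun t => ⟨expUnit (t • A), (hA.smul t).expUnit_mem_coneAut⟩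
  have hγ : Continuous γ := by
    refine Continuous.subtype_mk (Units.continuous_iff.2 ⟨?_, ?_⟩) _
    · change Continuous fun t : ℝ => NormedSpace.exp (t • A)
      exact NormedSpace.exp_continuous.comp (continuous_id.smul continuous_const)
    · change Continuous fun t : ℝ => NormedSpace.exp (-(t • A))
      exact NormedSpace.exp_continuous.comp (continuous_id.smul continuous_const).neg
  have h0 : γ 0 = 1 := by
    apply Subtype.ext
    apply Units.ext
    simp [γ, expUnit_val]
  have hsub := (isPreconnected_range hγ).subset_connectedComponent (x := 1) ⟨0, h0⟩
  refine ⟨γ 1, hsub ⟨1, rfl⟩, ?_⟩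
  simp [γ]

theorem G_le_coneAut : G E ≤ coneAut E := by
  rintro _ ⟨g, -, rfl⟩
  exact g.2

theorem exp_apply_of_eigen {A : E →L[ℝ] E} {x : E} {t : ℝ} (h : A x = t • x) :
    NormedSpace.exp A x = Real.exp t • x := by
  have hd : ∀ u : ℝ, HasDerivAt (fun u : ℝ => Real.exp (-(u * t)) • NormedSpace.exp (u • A) x)
      0 u := by
    intro u
    have hcomm : A (NormedSpace.exp (u • A) x) = t • NormedSpace.exp (u • A) x := by
      have := FiniteDimensional.complete ℝ E
      have h2 : Commute A (NormedSpace.exp (u • A)) :=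
        ((Commute.refl A).smul_right u).exp_right
      have := congrArg (fun T : E →L[ℝ] E => T x) h2.eq
      simp only [mul_apply_eq_comp] at this
      rw [this, h, map_smul]
    have h1 := (((hasDerivAt_id u).mul_const t).neg.exp).smul (hasDerivAt_exp_apply A x u)
    refine (show HasDerivAt (fun u : ℝ => Real.exp (-(u * t)) • NormedSpace.exp (u • A) x) _ u
      from h1).congr_deriv ?_
    rw [hcomm]
    simp only [id, Pi.neg_apply]
    module
  have hconst := is_const_of_deriv_eq_zero (fun u => (hd u).differentiableAt)
    (fun u => (hd u).deriv) 1 0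
  simp only [one_mul, one_smul, zero_mul, neg_zero, Real.exp_zero, zero_smul,
    NormedSpace.exp_zero, one_apply_eq_self] at hconst
  conv_rhs => rw [← hconst]
  rw [smul_smul, ← Real.exp_add]; simp

/-- The flow of a skew operator is orthogonal. -/
theorem inner_exp_of_skew {A : E →L[ℝ] E} (hA : ∀ x y, inner ℝ (A x) y = - inner ℝ x (A y))
    (x y : E) : inner ℝ (NormedSpace.exp A x) (NormedSpace.exp A y) = inner ℝ x y := by
  have hd : ∀ u : ℝ, HasDerivAt (fun u : ℝ =>
      inner ℝ (NormedSpace.exp (u • A) x) (NormedSpace.exp (u • A) y)) 0 u := by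
    intro u
    refine ((hasDerivAt_exp_apply A x u).inner ℝ (hasDerivAt_exp_apply A y u)).congr_deriv ?_
    rw [hA]; ring
  have hconst := is_const_of_deriv_eq_zero (fun u => (hd u).differentiableAt)
    (fun u => (hd u).deriv) 1 0
  simpa using hconst

end Exponential

/-! ### The stabilizer of the unit and the primitive idempotents -/

section Transitivity

variable {E : Type*} [NormedAddCommGroup E] [InnerProductSpace ℝ E] [EuclideanJordanAlgebra E]
  [FiniteDimensional ℝ E]

local infixl:70 " ⊙ " => EuclideanJordanAlgebra.mul

theorem unit_sub_idem {c : E} (hc : c ⊙ c = c) : (unit - c) ⊙ (unit - c) = unit - c := by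
  simp [hc, mul_unit, unit_mul]

/-- Idempotents are characterized by the order. -/
theorem idem_iff {c : E} : c ⊙ c = c ↔ c ∈ squares E ∧ unit - c ∈ squares E ∧
    ∀ z ∈ squares E, c - z ∈ squares E → unit - c - z ∈ squares E → z = 0 := by
  constructor
  · intro hc
    have hc' := unit_sub_idem hc
    refine ⟨idem_mem_squares hc, idem_mem_squares hc', fun z hz h1 h2 => ?_⟩
    have h0 : inner ℝ c (unit - c) = 0 := by
      apply inner_eq_zero_of_mul_eq_zero
      rw [map_sub, mul_unit, hc, sub_self]
    have h3 := inner_squares_nonneg h1 (idem_mem_squares hc')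
    have h4 := inner_squares_nonneg h2 (idem_mem_squares hc)
    rw [inner_sub_left, h0] at h3
    rw [inner_sub_left, real_inner_comm, h0] at h4
    refine eq_zero_of_mem_squares_of_inner_unit hz ?_
    rw [inner_sub_right] at h3
    linarith
  · rintro ⟨h1, h2, h3⟩
    obtain ⟨r, c, l, hc, rfl⟩ := exists_spectral c
    have hu := hc.smul_unit 1
    rw [one_smul] at hu
    have hsub : unit - ∑ i, l i • c i = ∑ i, (1 - l i) • c i := by
      rw [hu, ← Finset.sum_sub_distrib]
      exact Finset.sum_congr rfl fun i _ => by rw [sub_smul]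
    rw [hsub, sum_mem_squares_iff hc] at h2
    rw [sum_mem_squares_iff hc] at h1
    -- This is a common lower bound of `c` and `e - c`; its vanishing forces every eigenvalue to be
    -- `0` or `1`.
    have hz := h3 (∑ i, min (l i) (1 - l i) • c i)
      (sum_mem_squares hc fun i => le_min (h1 i) (h2 i)) ?_ ?_
    · have h4 : ∀ i, l i * l i = l i := by
        intro i
        have h5 := hc.inner_sum i fun i => min (l i) (1 - l i)
        rw [hz, inner_zero_left] at h5
        have h6 : min (l i) (1 - l i) = 0 :=
          (mul_eq_zero.1 h5.symm).resolve_right (hc.inner_self_pos i).ne'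
        rcases min_choice (l i) (1 - l i) with h | h <;> rw [h] at h6
        · rw [h6, mul_zero]
        · rw [show l i = 1 by linarith, mul_one]
      rw [hc.sum_mul_sum]
      simp only [h4]
    · rw [← Finset.sum_sub_distrib]
      simp only [← sub_smul]
      exact sum_mem_squares hc fun i => sub_nonneg.2 (min_le_left _ _)
    · rw [hsub, ← Finset.sum_sub_distrib]
      simp only [← sub_smul]
      exact sum_mem_squares hc fun i => sub_nonneg.2 (min_le_right _ _)

theorem mem_squares_of_mem_coneAut {g : (E →L[ℝ] E)ˣ} (hg : g ∈ coneAut E) {x : E}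
    (hx : x ∈ squares E) : (g : E →L[ℝ] E) x ∈ squares E := by
  rw [← image_squares_of_mem_coneAut hg]; exact ⟨x, hx, rfl⟩

theorem mem_cone_of_mem_coneAut {g : (E →L[ℝ] E)ˣ} (hg : g ∈ coneAut E) {x : E}
    (hx : x ∈ cone E) : (g : E →L[ℝ] E) x ∈ cone E := by
  rw [← mem_coneAut_iff.1 hg]; exact ⟨x, hx, rfl⟩

theorem inv_apply_unit {g : (E →L[ℝ] E)ˣ} (he : (g : E →L[ℝ] E) unit = unit) :
    ((g⁻¹ : (E →L[ℝ] E)ˣ) : E →L[ℝ] E) unit = unit := by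
  conv_lhs => rw [← he]
  exact units_inv_apply g unit

theorem idem_of_mem_coneAut {g : (E →L[ℝ] E)ˣ} (hg : g ∈ coneAut E)
    (he : (g : E →L[ℝ] E) unit = unit) {c : E} (hc : c ⊙ c = c) :
    (g : E →L[ℝ] E) c ⊙ (g : E →L[ℝ] E) c = (g : E →L[ℝ] E) c := by
  obtain ⟨h1, h2, h3⟩ := idem_iff.1 hc
  have hg' := (coneAut E).inv_mem hg
  have he' := inv_apply_unit he
  refine idem_iff.2 ⟨mem_squares_of_mem_coneAut hg h1, ?_, ?_⟩
  · have := mem_squares_of_mem_coneAut hg h2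
    rwa [map_sub, he] at this
  · intro z hz h4 h5
    have h6 := h3 _ (mem_squares_of_mem_coneAut hg' hz) ?_ ?_
    · rw [← units_apply_inv g z, h6, map_zero]
    · have := mem_squares_of_mem_coneAut hg' h4
      rwa [map_sub, units_inv_apply] at this
    · have := mem_squares_of_mem_coneAut hg' h5
      rwa [map_sub, map_sub, units_inv_apply, he'] at this

theorem primitive_of_mem_coneAut {g : (E →L[ℝ] E)ˣ} (hg : g ∈ coneAut E)
    (he : (g : E →L[ℝ] E) unit = unit) {c : E} (hc : IsPrimitive c) :
    IsPrimitive ((g : E →L[ℝ] E) c) := by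
  have hg' := (coneAut E).inv_mem hg
  have he' := inv_apply_unit he
  have hinj : ∀ {g : (E →L[ℝ] E)ˣ} {x : E}, x ≠ 0 → (g : E →L[ℝ] E) x ≠ 0 := by
    intro g x hx h
    exact hx (by rw [← units_inv_apply g x, h, map_zero])
  refine ⟨⟨idem_of_mem_coneAut hg he hc.1.1, hinj hc.1.2⟩, ?_⟩
  rintro ⟨a, b, ha, hb, hab⟩
  refine hc.2 ⟨_, _, ⟨idem_of_mem_coneAut hg' he' ha.1, hinj ha.2⟩,
    ⟨idem_of_mem_coneAut hg' he' hb.1, hinj hb.2⟩, ?_⟩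
  rw [← map_add, ← hab, units_inv_apply]

variable (E) in
/-- The elements of `K` which fix the unit. -/
def unitStabilizer : Subgroup (E →L[ℝ] E)ˣ where
  carrier := {g | g ∈ K E ∧ (g : E →L[ℝ] E) unit = unit}
  one_mem' := ⟨⟨one_mem _, fun _ _ => rfl⟩, rfl⟩
  mul_mem' := by
    rintro a b ⟨⟨ha, ha'⟩, ha''⟩ ⟨⟨hb, hb'⟩, hb''⟩
    refine ⟨⟨mul_mem ha hb, fun x y => ?_⟩, ?_⟩
    · exact (ha' _ _).trans (hb' _ _)
    · exact (congrArg (a : E →L[ℝ] E) hb'').trans ha''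
  inv_mem' := by
    rintro a ⟨⟨ha, ha'⟩, ha''⟩
    refine ⟨⟨inv_mem ha, fun x y => ?_⟩, inv_apply_unit ha''⟩
    rw [← ha', units_apply_inv, units_apply_inv]

theorem expUnit_commutatorL_mem (a b : E) : expUnit (commutatorL a b) ∈ unitStabilizer E := by
  refine ⟨⟨(isTangent_commutatorL a b).expUnit_mem_G,
    inner_exp_of_skew (commutatorL_skew a b)⟩, ?_⟩
  have : commutatorL a b unit = (0 : ℝ) • unit := by rw [commutatorL_unit, zero_smul]
  rw [expUnit_val, exp_apply_of_eigen this, Real.exp_zero, one_smul]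

theorem continuous_mul_self : Continuous fun x : E => x ⊙ x := by
  let B : E →L[ℝ] E →L[ℝ] E :=
    LinearMap.toContinuousLinearMap
      ((LinearMap.toContinuousLinearMap : (E →ₗ[ℝ] E) ≃ₗ[ℝ] (E →L[ℝ] E)).toLinearMap ∘ₗ mul)
  exact B.continuous.clm_apply continuous_id

/-- From `⟨e - d, y²⟩ = 0` and positivity, an idempotent of `y` with nonzero eigenvalue lies below
`d`; primitivity makes it equal to `d`. -/
theorem IsPrimitive.eq_smul {d : E} (hd : IsPrimitive d) {y : E} (hy : d ⊙ y = y) :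
    ∃ a : ℝ, y = a • d := by
  by_cases hy0 : y = 0
  · exact ⟨0, by simp [hy0]⟩
  obtain ⟨r, c, l, hc, rfl⟩ := exists_spectral y
  obtain ⟨i, hi⟩ : ∃ i, l i ≠ 0 := by
    by_contra! h
    exact hy0 (Finset.sum_eq_zero fun i _ => by rw [h i, zero_smul])
  have hd' := unit_sub_idem hd.1.1
  have h1 : inner ℝ (unit - d) ((∑ i, l i • c i) ⊙ (∑ i, l i • c i)) = 0 := by
    rw [inner_mul, map_sub, LinearMap.sub_apply, hy, unit_mul, sub_self, inner_zero_left]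
  rw [hc.sum_mul_sum, inner_sum] at h1
  have h2 := (Finset.sum_eq_zero_iff_of_nonneg fun i _ => by
    rw [real_inner_smul_right]
    exact mul_nonneg (mul_self_nonneg _) (inner_idem_nonneg hd' (hc.idem i))).1 h1 i
      (Finset.mem_univ i)
  rw [real_inner_smul_right] at h2
  have h3 := mul_eq_zero_of_inner_idem hd' (hc.idem i)
    ((mul_eq_zero.1 h2).resolve_left (mul_self_ne_zero.2 hi))
  rw [map_sub, LinearMap.sub_apply, unit_mul, sub_eq_zero] at h3
  have h4 : d - c i = 0 := by
    by_contra hne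
    refine hd.2 ⟨c i, d - c i, ⟨hc.idem i, hc.ne_zero i⟩, ⟨?_, hne⟩, by abel⟩
    simp [hd.1.1, hc.idem, ← h3, mul_comm (c i) d]
  refine ⟨l i, ?_⟩
  rw [← hy, sub_eq_zero.1 h4, hc.mul_sum]

variable (E) in
theorem unitStabilizer_le_coneAut : unitStabilizer E ≤ coneAut E :=
  fun _ hg => G_le_coneAut hg.1.1

/-- The orbit of `c` under the stabilizer of the unit. -/
def orbit (c : E) : Set E := {x | ∃ u ∈ unitStabilizer E, x = (u : E →L[ℝ] E) c}

theorem self_mem_orbit (c : E) : c ∈ orbit c := ⟨1, one_mem _, rfl⟩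

theorem map_mem_closure_orbit {c x : E} (hx : x ∈ closure (orbit c)) {u : (E →L[ℝ] E)ˣ}
    (hu : u ∈ unitStabilizer E) : (u : E →L[ℝ] E) x ∈ closure (orbit c) := by
  refine map_mem_closure (u : E →L[ℝ] E).continuous hx ?_
  rintro _ ⟨v, hv, rfl⟩
  exact ⟨u * v, mul_mem hu hv, rfl⟩

theorem norm_eq_of_mem_unitStabilizer {u : (E →L[ℝ] E)ˣ} (hu : u ∈ unitStabilizer E) (x : E) :
    ‖(u : E →L[ℝ] E) x‖ = ‖x‖ := by
  rw [← sq_eq_sq₀ (norm_nonneg _) (norm_nonneg _), ← real_inner_self_eq_norm_sq,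
    ← real_inner_self_eq_norm_sq, hu.1.2]

theorem norm_eq_of_mem_closure_orbit {c x : E} (hx : x ∈ closure (orbit c)) : ‖x‖ = ‖c‖ := by
  have : closure (orbit c) ⊆ {x | ‖x‖ = ‖c‖} := by
    refine closure_minimal ?_ (isClosed_eq continuous_norm continuous_const)
    rintro _ ⟨u, hu, rfl⟩
    exact norm_eq_of_mem_unitStabilizer hu c
  exact this hx

theorem idem_of_mem_closure_orbit {c x : E} (hc : c ⊙ c = c) (hx : x ∈ closure (orbit c)) :
    x ⊙ x = x := by
  have : closure (orbit c) ⊆ {x | x ⊙ x = x} := by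
    refine closure_minimal ?_ (isClosed_eq continuous_mul_self continuous_id)
    rintro _ ⟨u, hu, rfl⟩
    exact idem_of_mem_coneAut (unitStabilizer_le_coneAut E hu) hu.2 hc
  exact this hx

/-- Critical points of the function `x ↦ ⟨x, d⟩` on an orbit commute with `d`. -/
theorem commute_of_isMaxOn {c d x : E} (hx : x ∈ closure (orbit c))
    (hmax : ∀ y ∈ closure (orbit c), inner ℝ y d ≤ inner ℝ x d) (v : E) :
    d ⊙ (x ⊙ v) = x ⊙ (d ⊙ v) := by
  have key : ∀ a b : E, inner ℝ (commutatorL a b x) d = 0 := by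
    intro a b
    have hd := (hasDerivAt_exp_apply (commutatorL a b) x 0).inner ℝ (hasDerivAt_const (0 : ℝ) d)
    have hloc : IsLocalMax
        (fun t : ℝ => inner ℝ (NormedSpace.exp (t • commutatorL a b) x) d) 0 := by
      refine Eventually.of_forall fun t => ?_
      simp only [zero_smul, NormedSpace.exp_zero, one_apply_eq_self]
      refine hmax _ ?_
      -- The whole one-parameter group stays in the stabilizer, so the curve through `x` remains in
      -- the orbit closure.
      have : t • commutatorL a b = commutatorL (t • a) b := by
        ext y; simp [commutatorL_apply, smul_sub]
      rw [this]
      exact map_mem_closure_orbit hx (expUnit_commutatorL_mem (t • a) b)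
    have := hloc.hasDerivAt_eq_zero hd
    simpa using this
  have h2 : ∀ a : E, inner ℝ a (d ⊙ (x ⊙ v) - x ⊙ (d ⊙ v)) = 0 := by
    intro a
    have := key a v
    have e1 : inner ℝ (a ⊙ (v ⊙ x)) d = inner ℝ a (d ⊙ (x ⊙ v)) := by
      rw [inner_mul_left, mul_comm a d, mul_comm v x, ← inner_mul_left, real_inner_comm]
    have e2 : inner ℝ (v ⊙ (a ⊙ x)) d = inner ℝ a (x ⊙ (d ⊙ v)) := by
      rw [inner_mul_left, mul_comm a x, mul_comm v d, inner_mul_left]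
    rw [commutatorL_apply, inner_sub_left, e1, e2] at this
    rw [inner_sub_right, this]
  exact sub_eq_zero.1 (inner_self_eq_zero.1 (h2 _))

/-- At a maximizer `x` of `⟨·, d⟩` the operators `L(x)` and `L(d)` commute, so `xd` is fixed by
`L(d)` and `xd = a d` with `a² = a`. If `a = 0`, the nonnegative function has maximum zero; if `a =
1`, then `⟨x, d⟩ = ‖d‖²`. -/
theorem exists_mem_closure_orbit {c d : E} (hc : c ⊙ c = c) (hd : IsPrimitive d) :
    (∀ u ∈ unitStabilizer E, inner ℝ ((u : E →L[ℝ] E) c) d = 0) ∨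
      ∃ x ∈ closure (orbit c), ‖x - d‖ ^ 2 = ‖c‖ ^ 2 - ‖d‖ ^ 2 := by
  have hbdd : Bornology.IsBounded (orbit c) := by
    refine (Metric.isBounded_closedBall (x := (0 : E)) (r := ‖c‖)).subset ?_
    rintro _ ⟨u, hu, rfl⟩
    rw [mem_closedBall_zero_iff, norm_eq_of_mem_unitStabilizer hu]
  have := FiniteDimensional.proper_real E
  obtain ⟨x, hx, hmax⟩ := (hbdd.isCompact_closure).exists_isMaxOn
    ⟨c, subset_closure (self_mem_orbit c)⟩
    (f := fun y => inner ℝ y d) (by fun_prop)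
  have hcomm := commute_of_isMaxOn hx fun y hy => hmax hy
  have hxx := idem_of_mem_closure_orbit hc hx
  obtain ⟨a, ha⟩ := hd.eq_smul (y := x ⊙ d) (by rw [hcomm, hd.1.1])
  have h1 : x ⊙ (x ⊙ d) = x ⊙ d := by
    have := hcomm x
    rw [hxx, mul_comm d x] at this
    exact this.symm
  have h2 : a * a = a := by
    rw [ha, map_smul, ha, smul_smul] at h1
    exact smul_left_injective ℝ hd.1.2 h1
  have h3 : inner ℝ x d = a * ‖d‖ ^ 2 := by
    rw [← hd.1.1, inner_mul, ha, real_inner_smul_left, real_inner_self_eq_norm_sq, hd.1.1]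
  rcases eq_or_ne a 0 with h0 | h0
  · left
    intro u hu
    refine le_antisymm ?_ ?_
    · have := hmax (subset_closure ⟨u, hu, rfl⟩ : (u : E →L[ℝ] E) c ∈ closure (orbit c))
      simpa [h3, h0] using this
    · exact inner_idem_nonneg
        (idem_of_mem_coneAut (unitStabilizer_le_coneAut E hu) hu.2 hc) hd.1.1
  · right
    have ha1 : a = 1 := mul_left_cancel₀ h0 (by rw [h2, mul_one])
    refine ⟨x, hx, ?_⟩
    rw [norm_sub_sq_real, h3, ha1, norm_eq_of_mem_closure_orbit hx]
    ring

/-- Applying the previous alternative in both directions gives `‖c‖ = ‖d‖`, and then the maximizer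
coincides with `d`. -/
theorem primitive_dichotomy {c d : E} (hc : IsPrimitive c) (hd : IsPrimitive d) :
    (∀ u ∈ unitStabilizer E, inner ℝ ((u : E →L[ℝ] E) c) d = 0) ∨ d ∈ closure (orbit c) := by
  rcases exists_mem_closure_orbit hc.1.1 hd with h | ⟨x, hx, hxd⟩
  · exact Or.inl h
  rcases exists_mem_closure_orbit hd.1.1 hc with h | ⟨y, hy, hyc⟩
  · left
    intro u hu
    have := h u⁻¹ (inv_mem hu)
    rw [← hu.1.2, units_apply_inv, real_inner_comm] at this
    exact this
  · right
    have h1 : ‖x - d‖ ^ 2 = 0 := by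
      nlinarith [sq_nonneg ‖x - d‖, sq_nonneg ‖y - c‖]
    have : x = d := by simpa [sub_eq_zero] using h1
    rwa [← this]

/-- In a simple algebra the stabilizer of the unit acts transitively, up to closure, on the
primitive idempotents. -/
theorem IsSimple.mem_closure_orbit (hE : IsSimple E) {c d : E} (hc : IsPrimitive c)
    (hd : IsPrimitive d) : d ∈ closure (orbit c) := by
  let SI : Set E := {x | IsPrimitive x ∧ x ∈ closure (orbit c)}
  let SJ : Set E := {x | IsPrimitive x ∧ ∀ u ∈ unitStabilizer E, inner ℝ ((u : E →L[ℝ] E) c) x = 0}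
  have hcover : ∀ x : E, x ∈ Submodule.span ℝ SI ⊔ Submodule.span ℝ SJ := by
    intro x
    obtain ⟨r, f, l, hf, rfl⟩ := exists_spectral x
    refine Submodule.sum_mem _ fun i _ => Submodule.smul_mem _ _ ?_
    rcases primitive_dichotomy hc (hf.primitive i) with h | h
    · exact Submodule.mem_sup_right (Submodule.subset_span ⟨hf.primitive i, h⟩)
    · exact Submodule.mem_sup_left (Submodule.subset_span ⟨hf.primitive i, h⟩)
  have horth : ∀ x ∈ SI, ∀ y ∈ SJ, inner ℝ x y = 0 := by
    rintro x ⟨-, hx⟩ y ⟨-, hy⟩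
    have : closure (orbit c) ⊆ {x | inner ℝ x y = 0} := by
      refine closure_minimal ?_ (isClosed_eq (by fun_prop) continuous_const)
      rintro _ ⟨u, hu, rfl⟩
      exact hy u hu
    exact this hx
  have hmul : ∀ x ∈ SI, ∀ y ∈ SJ, x ⊙ y = 0 := fun x hx y hy =>
    mul_eq_zero_of_inner_idem hx.1.1.1 hy.1.1.1 (horth x hx y hy)
  have hmul' : ∀ x ∈ Submodule.span ℝ SI, ∀ y ∈ Submodule.span ℝ SJ, x ⊙ y = 0 := by
    intro x hx y hy
    induction hx using Submodule.span_induction with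
    | zero => simp
    | add a b _ _ ha hb => simp [ha, hb]
    | smul t a _ ha => simp [ha]
    | mem x hx =>
      induction hy using Submodule.span_induction with
      | zero => simp
      | add a b _ _ ha hb => simp [ha, hb]
      | smul t a _ ha => simp [ha]
      | mem y hy => exact hmul x hx y hy
  have hcompl : IsCompl (Submodule.span ℝ SI) (Submodule.span ℝ SJ) := by
    refine ⟨Submodule.disjoint_def.2 fun x hx hy => ?_,
      codisjoint_iff.2 ((Submodule.eq_top_iff').2 hcover)⟩
    exact inner_self_eq_zero.1 (inner_eq_zero_of_mul_eq_zero (hmul' x hx x hy))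
  have hself : ∀ (A B : Submodule ℝ E), A ⊔ B = ⊤ → (∀ a ∈ A, ∀ b ∈ B, a ⊙ b = 0) →
      (∀ a ∈ A, ∀ b ∈ A, a ⊙ b ∈ Bᗮ) := by
    intro A B _ hAB a ha b hb
    rw [Submodule.mem_orthogonal']
    intro z hz
    rw [← inner_mul, hAB b hb z hz, inner_zero_right]
  have hortho : ∀ (A B : Submodule ℝ E), A ⊔ B = ⊤ → (∀ a ∈ A, ∀ b ∈ B, a ⊙ b = 0) →
      ∀ x ∈ Bᗮ, x ∈ A := by
    intro A B hAB h x hx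
    obtain ⟨a, ha, b, hb, rfl⟩ := Submodule.mem_sup.1 (hAB ▸ Submodule.mem_top : x ∈ A ⊔ B)
    have h1 := (Submodule.mem_orthogonal' _ _).1 hx b hb
    rw [inner_add_left, inner_eq_zero_of_mul_eq_zero (h a ha b hb), zero_add] at h1
    rw [inner_self_eq_zero.1 h1, add_zero]; exact ha
  -- Two spanning subspaces that annihilate each other are ideals: associativity of the inner
  -- product puts `A ⊙ A` into `Bᗮ`, which lies in `A`.
  have hideal : ∀ (A B : Submodule ℝ E), A ⊔ B = ⊤ → (∀ a ∈ A, ∀ b ∈ B, a ⊙ b = 0) →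
      ∀ x : E, ∀ y ∈ A, x ⊙ y ∈ A := by
    intro A B hAB h x y hy
    obtain ⟨a, ha, b, hb, rfl⟩ := Submodule.mem_sup.1 (hAB ▸ Submodule.mem_top : x ∈ A ⊔ B)
    rw [map_add, LinearMap.add_apply, mul_comm b y, h y hy b hb, add_zero]
    exact hortho A B hAB h _ (hself A B hAB h a ha y hy)
  have htop := codisjoint_iff.1 hcompl.2
  rcases hE.eq_bot_or_eq_bot _ _ (hideal _ _ htop hmul')
    (hideal _ _ (by rw [sup_comm]; exact htop) fun a ha b hb => by
      rw [mul_comm]; exact hmul' b hb a ha) hcompl with h | h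
  · exfalso
    have : c ∈ Submodule.span ℝ SI :=
      Submodule.subset_span ⟨hc, subset_closure (self_mem_orbit c)⟩
    rw [h, Submodule.mem_bot] at this
    exact hc.1.2 this
  · rcases primitive_dichotomy hc hd with h' | h'
    · exfalso
      have : d ∈ Submodule.span ℝ SJ := Submodule.subset_span ⟨hd, h'⟩
      rw [h, Submodule.mem_bot] at this
      exact hd.1.2 this
    · exact h'

theorem IsSimple.norm_eq (hE : IsSimple E) {c d : E} (hc : IsPrimitive c)
    (hd : IsPrimitive d) : ‖c‖ = ‖d‖ :=
  (norm_eq_of_mem_closure_orbit (hE.mem_closure_orbit hc hd)).symm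

/-- Automorphisms of the cone which fix the unit are orthogonal. -/
theorem IsSimple.mem_unitStabilizer (hE : IsSimple E) {g : (E →L[ℝ] E)ˣ} (hg : g ∈ G E)
    (he : (g : E →L[ℝ] E) unit = unit) : g ∈ unitStabilizer E := by
  have hg' := G_le_coneAut hg
  have hnorm : ∀ x : E, ‖(g : E →L[ℝ] E).toLinearMap x‖ = ‖x‖ := by
    intro x
    obtain ⟨r, c, l, hc, rfl⟩ := exists_spectral x
    -- The sum of two orthogonal idempotents is idempotent, and its image is again idempotent; this
    -- forces the images to annihilate each other.
    have horth : ∀ i j, i ≠ j →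
        inner ℝ ((g : E →L[ℝ] E) (c i)) ((g : E →L[ℝ] E) (c j)) = 0 := by
      intro i j hij
      apply inner_eq_zero_of_mul_eq_zero
      apply mul_eq_zero_of_idem_add (idem_of_mem_coneAut hg' he (hc.idem i))
        (idem_of_mem_coneAut hg' he (hc.idem j))
      rw [← map_add]
      apply idem_of_mem_coneAut hg' he
      simp [hc.idem, hc.orthogonal i j hij, hc.orthogonal j i hij.symm]
    rw [← sq_eq_sq₀ (norm_nonneg _) (norm_nonneg _), ← real_inner_self_eq_norm_sq,
      ← real_inner_self_eq_norm_sq, map_sum]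
    simp only [sum_inner, inner_sum, map_smul, real_inner_smul_left, real_inner_smul_right]
    refine Finset.sum_congr rfl fun i _ => Finset.sum_congr rfl fun j _ => ?_
    congr 2
    by_cases hij : i = j
    · subst hij
      rw [real_inner_self_eq_norm_sq, real_inner_self_eq_norm_sq]
      congr 1
      exact hE.norm_eq (primitive_of_mem_coneAut hg' he (hc.primitive i)) (hc.primitive i)
    · rw [inner_eq_zero_of_mul_eq_zero (hc.orthogonal j i (Ne.symm hij))]
      exact horth j i (Ne.symm hij)
  refine ⟨⟨hg, fun x y => ?_⟩, he⟩
  exact LinearIsometry.inner_map_map ⟨(g : E →L[ℝ] E).toLinearMap, hnorm⟩ x y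

end Transitivity

end EuclideanJordanAlgebra

/-! ### The functional equation on the open unit box -/

section RealEquation

variable {I : Type*} [Fintype I]

/-- The linear combination of logarithms with coefficients `κ`. -/
noncomputable def logSum (κ x : I → ℝ) : ℝ := ∑ i, κ i * Real.log (x i)

theorem logSum_mul (κ : I → ℝ) {x y : I → ℝ} (hx : ∀ i, 0 < x i) (hy : ∀ i, 0 < y i) :
    logSum κ (x * y) = logSum κ x + logSum κ y := by
  simp only [logSum, Pi.mul_apply]
  rw [← Finset.sum_add_distrib]
  exact Finset.sum_congr rfl fun i _ => by rw [Real.log_mul (hx i).ne' (hy i).ne']; ring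

theorem logSum_div (κ : I → ℝ) {x y : I → ℝ} (hx : ∀ i, 0 < x i) (hy : ∀ i, 0 < y i) :
    logSum κ (x / y) = logSum κ x - logSum κ y := by
  simp only [logSum, Pi.div_apply]
  rw [← Finset.sum_sub_distrib]
  exact Finset.sum_congr rfl fun i _ => by rw [Real.log_div (hx i).ne' (hy i).ne']; ring

variable (I) in
/-- The open unit box. -/
def unitBox : Set (I → ℝ) := {x | ∀ i, 0 < x i ∧ x i < 1}

theorem isOpen_unitBox : IsOpen (unitBox I) := by
  have : unitBox I = Set.univ.pi fun _ => Set.Ioo (0 : ℝ) 1 := by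
    ext x; simp [unitBox]
  rw [this]
  exact isOpen_set_pi Set.finite_univ fun _ _ => isOpen_Ioo

theorem continuousOn_logSum (κ : I → ℝ) : ContinuousOn (logSum κ) (unitBox I) := by
  refine continuousOn_finsetSum _ fun i _ => ContinuousOn.mul continuousOn_const ?_
  exact ContinuousOn.log (continuous_apply i).continuousOn fun x hx => (hx i).1.ne'

/-- Continuous solutions of the logarithmic Cauchy equation on the positive orthant. -/
theorem exists_eq_logSum {L : (I → ℝ) → ℝ} (hL : ContinuousAt L 1)
    (hmul : ∀ x y : I → ℝ, (∀ i, 0 < x i) → (∀ i, 0 < y i) → L (x * y) = L x + L y) :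
    ∃ κ : I → ℝ, ∀ x : I → ℝ, (∀ i, 0 < x i) → L x = logSum κ x := by
  classical
  let e : (I → ℝ) → (I → ℝ) := fun t i => Real.exp (t i)
  have he : ∀ t i, 0 < e t i := fun t i => Real.exp_pos _
  have he0 : e 0 = 1 := by ext i; simp [e]
  let ℓ : (I → ℝ) →+ ℝ := AddMonoidHom.mk' (fun t => L (e t)) fun s t => by
    rw [← hmul _ _ (he s) (he t)]
    congr 1
    ext i; simp [e, Real.exp_add]
  have hec : Continuous e := by fun_prop
  have hcont : Continuous ℓ := by
    refine continuous_of_continuousAt_zero ℓ ?_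
    change ContinuousAt (fun t => L (e t)) 0
    refine ContinuousAt.comp ?_ hec.continuousAt
    rwa [he0]
  let T := ℓ.toRealLinearMap hcont
  refine ⟨fun i => T (fun j => if i = j then 1 else 0), fun x hx => ?_⟩
  have h1 : x = e (fun i => Real.log (x i)) := by
    ext i; simp [e, Real.exp_log (hx i)]
  have h2 : L x = T.toLinearMap (fun i => Real.log (x i)) := by
    conv_lhs => rw [h1]
    rfl
  rw [h2, logSum, LinearMap.pi_apply_eq_sum_univ]
  refine Finset.sum_congr rfl fun i _ => ?_
  rw [smul_eq_mul, mul_comm]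
  rfl

theorem eventually_smul_mem_unitBox {u : I → ℝ} (hu : ∀ i, 0 < u i) :
    ∀ᶠ α : ℝ in 𝓝[>] 0, α • u ∈ unitBox I := by
  have : ∀ i, ∀ᶠ α : ℝ in 𝓝[>] 0, 0 < α * u i ∧ α * u i < 1 := by
    intro i
    have h1 : Tendsto (fun α : ℝ => α * u i) (𝓝[>] 0) (𝓝 0) := by
      have : Continuous fun α : ℝ => α * u i := by fun_prop
      have := this.tendsto 0
      rw [zero_mul] at this
      exact this.mono_left nhdsWithin_le_nhds
    filter_upwards [self_mem_nhdsWithin, h1.eventually (gt_mem_nhds one_pos)] with α h2 h3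
    exact ⟨mul_pos h2 (hu i), h3⟩
  exact eventually_all.2 this

section

variable {p q : (I → ℝ) → ℝ} {c : ℝ}

/-- With `D = u + v - αuv`, the choice `x = u/D`, `y = v/D` makes the two quotients exactly `αv` and
`αu`. The remaining arguments converge inside the box, so continuity gives the limit although `p`
and `q` may blow up at the origin. -/
theorem tendsto_sub_of_equation (hp : ContinuousOn p (unitBox I)) (hq : ContinuousOn q (unitBox I))
    (heq : ∀ x ∈ unitBox I, ∀ y ∈ unitBox I, (∀ i, 1 < x i + y i) →
      p x + q ((x + y - 1) / x) = q y + p ((x + y - 1) / y) + c)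
    {u v : I → ℝ} (hu : ∀ i, 0 < u i) (hv : ∀ i, 0 < v i) :
    Tendsto (fun α : ℝ => q (α • v) - p (α • u)) (𝓝[>] 0)
      (𝓝 (q (v / (u + v)) - p (u / (u + v)) + c)) := by
  have hbox : ∀ u v : I → ℝ, (∀ i, 0 < u i) → (∀ i, 0 < v i) → u / (u + v) ∈ unitBox I := by
    intro u v hu hv i
    have h1 := hu i
    have h2 := hv i
    simp only [Pi.div_apply, Pi.add_apply]
    refine ⟨by positivity, ?_⟩
    rw [div_lt_one (by positivity)]; linarith
  have hlim : ∀ u v w : I → ℝ, (∀ i, 0 < u i) → (∀ i, 0 < v i) →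
      Tendsto (fun α : ℝ => (w / (u + v - α • (u * v)) : I → ℝ)) (𝓝[>] 0) (𝓝 (w / (u + v))) := by
    intro u v w hu hv
    rw [tendsto_pi_nhds]
    intro i
    have h1 : u i + v i ≠ 0 := by have := hu i; have := hv i; positivity
    have : ContinuousAt (fun α : ℝ => w i / (u i + v i - α * (u i * v i))) 0 := by
      refine ContinuousAt.div (by fun_prop) (by fun_prop) (by simpa using h1)
    have := this.tendsto.mono_left (nhdsWithin_le_nhds (s := Set.Ioi 0))
    simpa using this
  have hx := (hp.continuousAt (isOpen_unitBox.mem_nhds (hbox u v hu hv))).tendsto.comp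
    (hlim u v u hu hv)
  have hvu : v / (u + v) ∈ unitBox I := by rw [add_comm]; exact hbox v u hv hu
  have hy := (hq.continuousAt (isOpen_unitBox.mem_nhds hvu)).tendsto.comp (hlim u v v hu hv)
  refine ((hy.sub hx).add_const c).congr' ?_
  filter_upwards [eventually_smul_mem_unitBox hu, eventually_smul_mem_unitBox hv,
    self_mem_nhdsWithin] with α h1 h2 hα
  have hα : 0 < α := hα
  simp only [unitBox, Set.mem_ofPred_eq, Pi.smul_apply, smul_eq_mul] at h1 h2
  have haux : ∀ {a b D : ℝ}, 0 < a → 0 < D → a + b - D = α * a * b →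
      (a / D + b / D - 1) / (a / D) = α * b := by
    intro a b D ha hD h
    rw [← add_div, div_sub_one hD.ne', h, div_div_div_cancel_right₀ hD.ne']
    field_simp
  have hd1 : ∀ i, u i < u i + v i - α * (u i * v i) := fun i => by nlinarith [h1 i, hv i]
  have hd2 : ∀ i, v i < u i + v i - α * (u i * v i) := fun i => by nlinarith [h2 i, hu i]
  have hd : ∀ i, 0 < u i + v i - α * (u i * v i) := fun i => (hu i).trans (hd1 i)
  have key := heq (u / (u + v - α • (u * v))) ?_ (v / (u + v - α • (u * v))) ?_ ?_
  · have e1 : (u / (u + v - α • (u * v)) + v / (u + v - α • (u * v)) - 1) /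
        (u / (u + v - α • (u * v))) = α • v := by
      ext i
      simp only [Pi.div_apply, Pi.sub_apply, Pi.add_apply, Pi.smul_apply, Pi.mul_apply,
        Pi.one_apply, smul_eq_mul]
      exact haux (hu i) (hd i) (by ring)
    have e2 : (u / (u + v - α • (u * v)) + v / (u + v - α • (u * v)) - 1) /
        (v / (u + v - α • (u * v))) = α • u := by
      ext i
      simp only [Pi.div_apply, Pi.sub_apply, Pi.add_apply, Pi.smul_apply, Pi.mul_apply,
        Pi.one_apply, smul_eq_mul]
      rw [add_comm (u i / _)]
      exact haux (hv i) (hd i) (by ring)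
    rw [e1, e2] at key
    simp only [Function.comp]
    linarith
  · intro i
    simp only [Pi.div_apply, Pi.sub_apply, Pi.add_apply, Pi.smul_apply, Pi.mul_apply, smul_eq_mul]
    exact ⟨div_pos (hu i) (hd i), (div_lt_one (hd i)).2 (hd1 i)⟩
  · intro i
    simp only [Pi.div_apply, Pi.sub_apply, Pi.add_apply, Pi.smul_apply, Pi.mul_apply, smul_eq_mul]
    exact ⟨div_pos (hv i) (hd i), (div_lt_one (hd i)).2 (hd2 i)⟩
  · intro i
    simp only [Pi.div_apply, Pi.sub_apply, Pi.add_apply, Pi.smul_apply, Pi.mul_apply, smul_eq_mul]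
    rw [← add_div, one_lt_div (hd i)]
    have := mul_pos hα (mul_pos (hu i) (hv i))
    linarith

/-- The limit `Φ(u, v)` is unchanged when both arguments are scaled by the same vector, and as a
limit of `q(αv) - p(αu)` it separates its variables. Together these make `Φ(1, ·) - Φ(1, 1)`
logarithmic. -/
theorem exists_logSum_of_equation (hp : ContinuousOn p (unitBox I))
    (hq : ContinuousOn q (unitBox I))
    (heq : ∀ x ∈ unitBox I, ∀ y ∈ unitBox I, (∀ i, 1 < x i + y i) →
      p x + q ((x + y - 1) / x) = q y + p ((x + y - 1) / y) + c) :
    ∃ (κ : I → ℝ) (C : ℝ),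
      (∀ a ∈ unitBox I, q (1 - a) - p a = logSum κ (1 - a) - logSum κ a + C) ∧
      ∀ u v : I → ℝ, (∀ i, 0 < u i) → (∀ i, 0 < v i) →
        Tendsto (fun α : ℝ => p (α • u) - p (α • v)) (𝓝[>] 0) (𝓝 (logSum κ u - logSum κ v)) := by
  let Φ : (I → ℝ) → (I → ℝ) → ℝ := fun u v => q (v / (u + v)) - p (u / (u + v)) + c
  have hΦ : ∀ u v : I → ℝ, (∀ i, 0 < u i) → (∀ i, 0 < v i) →
      Tendsto (fun α : ℝ => q (α • v) - p (α • u)) (𝓝[>] 0) (𝓝 (Φ u v)) :=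
    fun u v hu hv => tendsto_sub_of_equation hp hq heq hu hv
  have h1 : ∀ i : I, (0 : ℝ) < (1 : I → ℝ) i := fun _ => one_pos
  have hsplit : ∀ u v v' : I → ℝ, (∀ i, 0 < u i) → (∀ i, 0 < v i) → (∀ i, 0 < v' i) →
      Φ u v - Φ u v' = Φ 1 v - Φ 1 v' := by
    intro u v v' hu hv hv'
    refine tendsto_nhds_unique (((hΦ u v hu hv).sub (hΦ u v' hu hv')).congr fun α => ?_)
      ((hΦ 1 v h1 hv).sub (hΦ 1 v' h1 hv'))
    ring
  have hscale : ∀ s u v : I → ℝ, (∀ i, 0 < s i) → Φ (s * u) (s * v) = Φ u v := by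
    intro s u v hs
    have e : ∀ w : I → ℝ, s * w / (s * u + s * v) = w / (u + v) := by
      intro w
      ext i
      simp only [Pi.div_apply, Pi.mul_apply, Pi.add_apply]
      rw [← mul_add, mul_div_mul_left _ _ (hs i).ne']
    simp only [Φ, e]
  have hpos : ∀ x y : I → ℝ, (∀ i, 0 < x i) → (∀ i, 0 < y i) → ∀ i, 0 < (x * y) i :=
    fun x y hx hy i => mul_pos (hx i) (hy i)
  have hmul : ∀ s v : I → ℝ, (∀ i, 0 < s i) → (∀ i, 0 < v i) →
      Φ 1 (s * v) - Φ 1 1 = (Φ 1 s - Φ 1 1) + (Φ 1 v - Φ 1 1) := by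
    intro s v hs hv
    have e1 := hscale s 1 v hs
    have e2 := hscale s 1 1 hs
    have e3 := hsplit s (s * v) s hs (hpos _ _ hs hv) hs
    rw [mul_one] at e1 e2
    linarith
  have hc1 : ContinuousAt (fun s => Φ 1 s - Φ 1 1) 1 := by
    have hb : (1 / (1 + 1) : I → ℝ) ∈ unitBox I := fun i => by norm_num
    have ht1 : ContinuousAt (fun s : I → ℝ => (s / (1 + s) : I → ℝ)) 1 := by
      refine continuousAt_pi.2 fun i => ?_
      exact ContinuousAt.div (continuous_apply i).continuousAt
        (continuousAt_const.add (continuous_apply i).continuousAt) (by norm_num)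
    have ht2 : ContinuousAt (fun s : I → ℝ => (1 / (1 + s) : I → ℝ)) 1 := by
      refine continuousAt_pi.2 fun i => ?_
      exact ContinuousAt.div continuousAt_const
        (continuousAt_const.add (continuous_apply i).continuousAt) (by norm_num)
    have hq1 : ContinuousAt (fun s : I → ℝ => q (s / (1 + s))) 1 :=
      ContinuousAt.comp (g := q) (hq.continuousAt (isOpen_unitBox.mem_nhds hb)) ht1
    have hp1 : ContinuousAt (fun s : I → ℝ => p (1 / (1 + s))) 1 :=
      ContinuousAt.comp (g := p) (hp.continuousAt (isOpen_unitBox.mem_nhds hb)) ht2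
    exact ((hq1.sub hp1).add continuousAt_const).sub continuousAt_const
  obtain ⟨κ, hκ⟩ := exists_eq_logSum (L := fun s => Φ 1 s - Φ 1 1) hc1 hmul
  have hval : ∀ u v : I → ℝ, (∀ i, 0 < u i) → (∀ i, 0 < v i) →
      Φ u v = logSum κ v - logSum κ u + Φ 1 1 := by
    intro u v hu hv
    have e1 := hscale u 1 1 hu
    have e2 := hsplit u v u hu hv hu
    rw [mul_one] at e1
    have e3 := hκ u hu
    have e4 := hκ v hv
    linarith
  refine ⟨κ, Φ 1 1 - c, fun a ha => ?_, fun u v hu hv => ?_⟩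
  · have h2 : ∀ i, 0 < (1 - a) i := fun i => sub_pos.2 (ha i).2
    have := hval a (1 - a) (fun i => (ha i).1) h2
    simp only [Φ, add_sub_cancel, div_one] at this ⊢
    linarith
  · have := (hΦ v 1 hv h1).sub (hΦ u 1 hu h1)
    rw [hval v 1 hv h1, hval u 1 hu h1] at this
    refine (this.congr fun α => by ring).trans (le_of_eq ?_)
    congr 1; ring

/-- The case left after the logarithms are subtracted. The limit of `p(βs)` as `β → 0` is computed
to be `p(s/(1+s)) - c`, while the hypothesis says that it does not depend on `s`; every point of the
box is some `s/(1+s)`. -/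
theorem const_of_equation (hp : ContinuousOn p (unitBox I))
    (heq : ∀ x ∈ unitBox I, ∀ y ∈ unitBox I, (∀ i, 1 < x i + y i) →
      p x + q ((x + y - 1) / x) = q y + p ((x + y - 1) / y) + c) {C : ℝ}
    (hpq : ∀ a ∈ unitBox I, q (1 - a) = p a + C)
    (hlim : ∀ u v : I → ℝ, (∀ i, 0 < u i) → (∀ i, 0 < v i) →
        Tendsto (fun α : ℝ => p (α • u) - p (α • v)) (𝓝[>] 0) (𝓝 0)) :
    ∃ C' : ℝ, ∀ a ∈ unitBox I, p a = C' := by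
  let β : ℝ → ℝ := fun α => α / (1 - α)
  have hβ : Tendsto β (𝓝[>] 0) (𝓝[>] 0) := by
    refine tendsto_nhdsWithin_iff.2 ⟨?_, ?_⟩
    · have : ContinuousAt β 0 := ContinuousAt.div (by fun_prop) (by fun_prop) (by norm_num)
      have := this.tendsto.mono_left (nhdsWithin_le_nhds (s := Set.Ioi 0))
      simpa [β] using this
    · have : ∀ᶠ α : ℝ in 𝓝[>] 0, α < 1 :=
        nhdsWithin_le_nhds (gt_mem_nhds one_pos)
      filter_upwards [self_mem_nhdsWithin, this] with α h1 h2
      exact div_pos h1 (sub_pos.2 h2)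
  have h1 : ∀ i : I, (0 : ℝ) < (1 : I → ℝ) i := fun _ => one_pos
  have key : ∀ s : I → ℝ, (∀ i, 0 < s i) →
      Tendsto (fun α => p (β α • s)) (𝓝[>] 0) (𝓝 (p (s / (1 + s)) - c)) := by
    intro s hs
    have hs1 : ∀ i, 0 < (1 + s) i := fun i => add_pos one_pos (hs i)
    have hsb : s / (1 + s) ∈ unitBox I := by
      intro i
      have := hs i
      simp only [Pi.div_apply, Pi.add_apply, Pi.one_apply]
      refine ⟨by positivity, ?_⟩
      rw [div_lt_one (by positivity)]; linarith
    let γ : ℝ → I → ℝ := fun α => (1 - α)⁻¹ • (s / (1 + s))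
    have hγ : Tendsto γ (𝓝[>] 0) (𝓝 (s / (1 + s))) := by
      have : ContinuousAt γ 0 := by
        refine ContinuousAt.smul (ContinuousAt.inv₀ (f := fun α : ℝ => 1 - α) (by fun_prop)
          (by norm_num))
          continuousAt_const
      have := this.tendsto.mono_left (nhdsWithin_le_nhds (s := Set.Ioi 0))
      simpa [γ] using this
    have hpγ := (hp.continuousAt (isOpen_unitBox.mem_nhds hsb)).tendsto.comp hγ
    have hd := hlim (1 + s) 1 hs1 h1
    have hsum := (hpγ.add hd).sub_const c
    rw [add_zero] at hsum
    refine hsum.congr' ?_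
    have hα1 : ∀ᶠ α : ℝ in 𝓝[>] 0, α < 1 := nhdsWithin_le_nhds (gt_mem_nhds one_pos)
    filter_upwards [self_mem_nhdsWithin, hα1, hβ.eventually (eventually_smul_mem_unitBox hs),
      eventually_smul_mem_unitBox hs1, hγ.eventually (isOpen_unitBox.mem_nhds hsb)]
      with α hα hα1 hm hx hγb
    have hα : 0 < α := hα
    have hα' : 0 < 1 - α := sub_pos.2 hα1
    have hcompl : ∀ a ∈ unitBox I, 1 - a ∈ unitBox I := fun a ha i =>
      ⟨sub_pos.2 (ha i).2, by simpa using (ha i).1⟩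
    -- Since `β - α = αβ`, here `x + y - 1 = α(1 - βs)`: the quotient by `y` is the constant vector
    -- `α`, and the quotient by `x` is `1 - γ`.
    have e0 := heq (α • (1 + s)) hx (1 - β α • s) (hcompl _ hm) ?_
    · have e1 : (α • (1 + s) + (1 - β α • s) - 1) / (α • (1 + s)) = 1 - γ α := by
        ext i
        have := hs i
        simp only [γ, β, Pi.div_apply, Pi.sub_apply, Pi.add_apply, Pi.smul_apply, Pi.one_apply,
          smul_eq_mul]
        field_simp
        ring
      have e2 : (α • (1 + s) + (1 - β α • s) - 1) / (1 - β α • s) = α • (1 : I → ℝ) := by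
        ext i
        have h3 := (hm i).2
        simp only [β, Pi.div_apply, Pi.sub_apply, Pi.add_apply, Pi.smul_apply, Pi.one_apply,
          smul_eq_mul] at h3 ⊢
        rw [div_eq_iff (sub_pos.2 h3).ne']
        field_simp
        ring
      rw [e1, e2, hpq _ hγb, hpq _ hm] at e0
      simp only [Function.comp]
      linarith
    · intro i
      have h3 := (hx i).2
      have h4 := hs i
      simp only [β, Pi.sub_apply, Pi.add_apply, Pi.smul_apply, Pi.one_apply,
        smul_eq_mul] at h3 ⊢
      have : α / (1 - α) * s i < α * (1 + s i) := by
        rw [div_mul_eq_mul_div, div_lt_iff₀ hα']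
        nlinarith
      linarith
  refine ⟨p (1 / (1 + 1)), fun a ha => ?_⟩
  have hs : ∀ i, 0 < (a / (1 - a)) i := fun i => div_pos (ha i).1 (sub_pos.2 (ha i).2)
  have e1 := (key _ hs).sub (key 1 h1)
  have e2 := (hlim _ 1 hs h1).comp hβ
  have e3 := tendsto_nhds_unique e1 e2
  have e4 : a / (1 - a) / (1 + a / (1 - a)) = a := by
    ext i
    have := sub_pos.2 (ha i).2
    simp only [Pi.div_apply, Pi.sub_apply, Pi.add_apply, Pi.one_apply]
    field_simp
    ring
  rw [e4] at e3
  linarith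

/-- Continuous solutions of the equation on the unit box. -/
theorem eq_logSum_of_equation (hp : ContinuousOn p (unitBox I)) (hq : ContinuousOn q (unitBox I))
    (heq : ∀ x ∈ unitBox I, ∀ y ∈ unitBox I, (∀ i, 1 < x i + y i) →
      p x + q ((x + y - 1) / x) = q y + p ((x + y - 1) / y) + c) :
    ∃ (κ : I → ℝ) (C C' : ℝ), ∀ a ∈ unitBox I, p a = logSum κ a + C ∧ q a = logSum κ a + C' := by
  obtain ⟨κ, C, h1, h2⟩ := exists_logSum_of_equation hp hq heq
  have hlim : ∀ u v : I → ℝ, (∀ i, 0 < u i) → (∀ i, 0 < v i) →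
      Tendsto (fun α : ℝ => (fun x => p x - logSum κ x) (α • u) -
        (fun x => p x - logSum κ x) (α • v)) (𝓝[>] 0) (𝓝 0) := by
    intro u v hu hv
    have := (h2 u v hu hv).sub_const (logSum κ u - logSum κ v)
    rw [sub_self] at this
    refine this.congr' ?_
    filter_upwards [self_mem_nhdsWithin] with α hα
    have hα : 0 < α := hα
    have e : ∀ w : I → ℝ, (∀ i, 0 < w i) →
        logSum κ (α • w) = logSum κ (fun _ => α) + logSum κ w := by
      intro w hw
      rw [← logSum_mul κ (fun _ => hα) hw]; rfl
    simp only [e u hu, e v hv]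
    ring
  have heq' : ∀ x ∈ unitBox I, ∀ y ∈ unitBox I, (∀ i, 1 < x i + y i) →
      (p x - logSum κ x) + (q ((x + y - 1) / x) - logSum κ ((x + y - 1) / x)) =
        (q y - logSum κ y) + (p ((x + y - 1) / y) - logSum κ ((x + y - 1) / y)) + c := by
    intro x hx y hy hxy
    have hx' : ∀ i, 0 < x i := fun i => (hx i).1
    have hy' : ∀ i, 0 < y i := fun i => (hy i).1
    have hz : ∀ i, 0 < (x + y - 1) i := fun i => sub_pos.2 (hxy i)
    rw [logSum_div κ hz hx', logSum_div κ hz hy']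
    linarith [heq x hx y hy hxy]
  obtain ⟨C', hC'⟩ := const_of_equation (p := fun x => p x - logSum κ x)
    (q := fun x => q x - logSum κ x) (hp.sub (continuousOn_logSum κ)) heq' (C := C)
    (fun a ha => by linarith [h1 a ha]) hlim
  refine ⟨κ, C', C' + C, fun a ha => ?_⟩
  have hb : 1 - a ∈ unitBox I := fun i => ⟨sub_pos.2 (ha i).2, by simpa using (ha i).1⟩
  have e1 := hC' a ha
  have e2 := hC' (1 - a) hb
  have e3 := h1 (1 - a) hb
  rw [sub_sub_cancel] at e3
  exact ⟨by linarith, by linarith⟩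

end

end RealEquation

namespace EuclideanJordanAlgebra

/-! ### Behaviour at the origin and propagation of invariance -/

section Asymptotics

variable {E : Type*} [NormedAddCommGroup E] [InnerProductSpace ℝ E] [EuclideanJordanAlgebra E]
  [FiniteDimensional ℝ E]

theorem isOpen_D : IsOpen (D E) :=
  isOpen_cone.inter (isOpen_cone.preimage (continuous_const.sub continuous_id))

theorem unit_sub_mem_D {x : E} (hx : x ∈ D E) : unit - x ∈ D E :=
  ⟨hx.2, by rw [sub_sub_cancel]; exact hx.1⟩

theorem smul_mem_D {x : E} (hx : x ∈ D E) {s : ℝ} (h0 : 0 < s) (h1 : s ≤ 1) : s • x ∈ D E := by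
  refine ⟨smul_mem_cone hx.1 h0, ?_⟩
  have : unit - s • x = s • (unit - x) + (1 - s) • unit := by module
  rw [this]
  exact add_mem_cone (smul_mem_cone hx.2 h0)
    (smul_mem_squares (cone_subset_squares unit_mem_cone) (sub_nonneg.2 h1))

theorem smul_unit_mem_D {s : ℝ} (h0 : 0 < s) (h1 : s < 1) : s • (unit : E) ∈ D E := by
  refine ⟨smul_mem_cone unit_mem_cone h0, ?_⟩
  have : unit - s • (unit : E) = (1 - s) • unit := by module
  rw [this]
  exact smul_mem_cone unit_mem_cone (sub_pos.2 h1)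

theorem tendsto_sub_smul (a x : E) : Tendsto (fun α : ℝ => a - α • x) (𝓝[>] 0) (𝓝 a) := by
  have : Continuous fun α : ℝ => a - α • x := by fun_prop
  have := this.tendsto 0
  rw [zero_smul, sub_zero] at this
  exact this.mono_left nhdsWithin_le_nhds

theorem eventually_sub_smul_mem_cone {a : E} (ha : a ∈ cone E) (x : E) :
    ∀ᶠ α : ℝ in 𝓝[>] 0, a - α • x ∈ cone E :=
  (tendsto_sub_smul a x).eventually (isOpen_cone.mem_nhds ha)

theorem eventually_smul_mem_D {x : E} (hx : x ∈ cone E) : ∀ᶠ α : ℝ in 𝓝[>] 0, α • x ∈ D E := by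
  filter_upwards [self_mem_nhdsWithin, eventually_sub_smul_mem_cone unit_mem_cone x] with α h1 h2
  exact ⟨smul_mem_cone hx h1, h2⟩

theorem mem_D_of_mem_unitStabilizer {u : (E →L[ℝ] E)ˣ} (hu : u ∈ unitStabilizer E) {x : E}
    (hx : x ∈ D E) : (u : E →L[ℝ] E) x ∈ D E := by
  have hu' := unitStabilizer_le_coneAut E hu
  refine ⟨mem_cone_of_mem_coneAut hu' hx.1, ?_⟩
  have := mem_cone_of_mem_coneAut hu' hx.2
  rwa [map_sub, hu.2] at this

/-- Invariance under the stabilizer of the unit. -/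
def IsInvariant (φ : E → ℝ) : Prop :=
  ∀ u ∈ unitStabilizer E, ∀ x ∈ D E, φ ((u : E →L[ℝ] E) x) = φ x

theorem IsKInvariant.isInvariant {φ : E → ℝ} (h : IsKInvariant φ) : IsInvariant φ :=
  fun u hu x hx => h u hu.1 x hx

theorem IsInvariant.of_comp {φ : E → ℝ} {v : (E →L[ℝ] E)ˣ} (hv : v ∈ unitStabilizer E)
    (h : IsInvariant fun x => φ ((v : E →L[ℝ] E) x)) : IsInvariant φ := by
  intro u hu x hx
  have h1 := h (v⁻¹ * u * v) (mul_mem (mul_mem (inv_mem hv) hu) hv) _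
    (mem_D_of_mem_unitStabilizer (inv_mem hv) hx)
  have e : ∀ y, ((v⁻¹ * u * v : (E →L[ℝ] E)ˣ) : E →L[ℝ] E) y =
      (↑v⁻¹ : E →L[ℝ] E) ((u : E →L[ℝ] E) ((v : E →L[ℝ] E) y)) := fun _ => rfl
  simp only [e, units_apply_inv] at h1
  exact h1

theorem IsInvariant.comp {φ : E → ℝ} {v : (E →L[ℝ] E)ˣ} (hv : v ∈ unitStabilizer E)
    (h : IsInvariant φ) : IsInvariant fun x => φ ((v : E →L[ℝ] E) x) := by
  intro u hu x hx
  exact (h v hv _ (mem_D_of_mem_unitStabilizer hu hx)).trans ((h u hu x hx).trans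
    (h v hv x hx).symm)

/-- The data of the functional equation. -/
structure IsSolution (w w' : E → (E →L[ℝ] E)ˣ) (f g h k : E → ℝ) : Prop where
  alg : IsMultiplicationAlgorithm w
  alg' : IsMultiplicationAlgorithm w'
  homogeneous : ∀ s : ℝ, 0 < s → ∀ x ∈ cone E, (w (s • x) : E →L[ℝ] E) = s • (w x : E →L[ℝ] E)
  homogeneous' : ∀ s : ℝ, 0 < s → ∀ x ∈ cone E,
    (w' (s • x) : E →L[ℝ] E) = s • (w' x : E →L[ℝ] E)
  tendsto : Tendsto (fun x => (w x : E →L[ℝ] E)) (𝓝[cone E] unit) (𝓝 (w unit : E →L[ℝ] E))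
  tendsto' : Tendsto (fun x => (w' x : E →L[ℝ] E)) (𝓝[cone E] unit) (𝓝 (w' unit : E →L[ℝ] E))
  cont_f : ContinuousOn f (D E)
  cont_g : ContinuousOn g (D E)
  cont_h : ContinuousOn h (D E)
  cont_k : ContinuousOn k (D E)
  eq : ∀ x y : E, (x, y) ∈ D₀ E →
    f x + g ((↑(w (unit - x))⁻¹ : E →L[ℝ] E) y) = h y + k ((↑(w' (unit - y))⁻¹ : E →L[ℝ] E) x)

variable {w w' : E → (E →L[ℝ] E)ˣ} {f g h k : E → ℝ}

theorem IsSolution.symm (hs : IsSolution w w' f g h k) : IsSolution w' w h k f g where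
  alg := hs.alg'
  alg' := hs.alg
  homogeneous := hs.homogeneous'
  homogeneous' := hs.homogeneous
  tendsto := hs.tendsto'
  tendsto' := hs.tendsto
  cont_f := hs.cont_h
  cont_g := hs.cont_k
  cont_h := hs.cont_f
  cont_k := hs.cont_g
  eq := fun x y ⟨h1, h2, h3⟩ => (hs.eq y x ⟨h2, h1, by rw [add_comm]; exact h3⟩).symm

theorem IsMultiplicationAlgorithm.mem_coneAut (hw : IsMultiplicationAlgorithm w) {x : E}
    (hx : x ∈ cone E) : w x ∈ coneAut E := G_le_coneAut (hw.mem_G x hx)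

theorem IsMultiplicationAlgorithm.apply_mem (hw : IsMultiplicationAlgorithm w) {x y : E}
    (hx : x ∈ cone E) (hy : y ∈ cone E) : (w x : E →L[ℝ] E) y ∈ cone E :=
  mem_cone_of_mem_coneAut (hw.mem_coneAut hx) hy

theorem IsMultiplicationAlgorithm.inv_apply_mem (hw : IsMultiplicationAlgorithm w) {x y : E}
    (hx : x ∈ cone E) (hy : y ∈ cone E) : (↑(w x)⁻¹ : E →L[ℝ] E) y ∈ cone E :=
  mem_cone_of_mem_coneAut ((coneAut E).inv_mem (hw.mem_coneAut hx)) hy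

theorem IsMultiplicationAlgorithm.inv_apply_self (hw : IsMultiplicationAlgorithm w) {x : E}
    (hx : x ∈ cone E) : (↑(w x)⁻¹ : E →L[ℝ] E) x = unit := by
  have := units_inv_apply (w x) unit
  rwa [hw.apply_unit x hx] at this

theorem IsMultiplicationAlgorithm.inv_apply_mem_D (hw : IsMultiplicationAlgorithm w) {x y : E}
    (hx : x ∈ cone E) (hy : y ∈ cone E) (hxy : x - y ∈ cone E) :
    (↑(w x)⁻¹ : E →L[ℝ] E) y ∈ D E := by
  refine ⟨hw.inv_apply_mem hx hy, ?_⟩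
  rw [← hw.inv_apply_self hx, ← map_sub]
  exact hw.inv_apply_mem hx hxy

theorem IsMultiplicationAlgorithm.unit_mem (hE : IsSimple E) (hw : IsMultiplicationAlgorithm w) :
    w unit ∈ unitStabilizer E :=
  hE.mem_unitStabilizer (hw.mem_G _ unit_mem_cone) (hw.apply_unit _ unit_mem_cone)

theorem inv_apply_smul {s : ℝ} {u v : (E →L[ℝ] E)ˣ}
    (huv : (u : E →L[ℝ] E) = s • (v : E →L[ℝ] E)) (y : E) :
    (↑u⁻¹ : E →L[ℝ] E) (s • y) = (↑v⁻¹ : E →L[ℝ] E) y := by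
  have : s • y = (u : E →L[ℝ] E) ((↑v⁻¹ : E →L[ℝ] E) y) := by
    rw [huv, smul_apply, units_apply_inv]
  rw [this, units_inv_apply]

namespace IsSolution

/-- The asymptotic form of the equation as the first variable tends to zero. -/
theorem tendsto_sub (hs : IsSolution w w' f g h k) {x y : E} (hx : x ∈ cone E) (hy : y ∈ D E) :
    Tendsto (fun α : ℝ => f (α • x) - k (α • (↑(w' (unit - y))⁻¹ : E →L[ℝ] E) x)) (𝓝[>] 0)
      (𝓝 (h y - g ((↑(w unit)⁻¹ : E →L[ℝ] E) y))) := by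
  have := FiniteDimensional.complete ℝ E
  have h1 : Tendsto (fun α : ℝ => unit - α • x) (𝓝[>] 0) (𝓝[cone E] unit) :=
    tendsto_nhdsWithin_iff.2 ⟨tendsto_sub_smul _ _,
      eventually_sub_smul_mem_cone unit_mem_cone x⟩
  have h2 := (NormedRing.inverse_continuousAt (w unit)).tendsto.comp (hs.tendsto.comp h1)
  have h3 : Tendsto (fun α : ℝ => (↑(w (unit - α • x))⁻¹ : E →L[ℝ] E) y) (𝓝[>] 0)
      (𝓝 ((↑(w unit)⁻¹ : E →L[ℝ] E) y)) := by
    rw [Ring.inverse_unit] at h2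
    refine (((ContinuousLinearMap.apply ℝ E y).continuous.tendsto _).comp h2).congr fun α => ?_
    simp only [Function.comp, Ring.inverse_unit, ContinuousLinearMap.apply_apply]
  have h4 : (↑(w unit)⁻¹ : E →L[ℝ] E) y ∈ D E := hs.alg.inv_apply_mem_D unit_mem_cone hy.1 hy.2
  have h5 := (hs.cont_g.continuousAt (isOpen_D.mem_nhds h4)).tendsto.comp h3
  refine (h5.const_sub (h y)).congr' ?_
  filter_upwards [eventually_smul_mem_D hx, eventually_sub_smul_mem_cone hy.2 x] with α h6 h7
  have h8 := hs.eq (α • x) y ⟨h6, hy, ?_, ?_⟩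
  · rw [map_smul] at h8
    simp only [Function.comp]
    linarith
  · exact add_mem_cone h6.1 (cone_subset_squares hy.1)
  · rwa [add_comm, ← sub_sub]

theorem tendsto_sub' (hs : IsSolution w w' f g h k) {a z : E} (ha : a ∈ D E) (hz : z ∈ cone E) :
    Tendsto (fun α : ℝ => f (α • (w' a : E →L[ℝ] E) z) - k (α • z)) (𝓝[>] 0)
      (𝓝 (h (unit - a) - g ((↑(w unit)⁻¹ : E →L[ℝ] E) (unit - a)))) := by
  have := hs.tendsto_sub (hs.alg'.apply_mem ha.1 hz) (unit_sub_mem_D ha)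
  rw [sub_sub_cancel] at this
  simpa only [units_inv_apply] using this

/-- Using `a` and `b` with the same `z = w'(b)⁻¹ x` cancels `k`. The limit does not depend on `x`,
which is the source of additivity. -/
theorem tendsto_ratio (hs : IsSolution w w' f g h k) {a b x : E} (ha : a ∈ D E) (hb : b ∈ D E) (hx : x ∈ cone E) :
    Tendsto (fun α : ℝ => f (α • (w' a : E →L[ℝ] E) ((↑(w' b)⁻¹ : E →L[ℝ] E) x)) - f (α • x))
      (𝓝[>] 0) (𝓝 ((h (unit - a) - g ((↑(w unit)⁻¹ : E →L[ℝ] E) (unit - a))) -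
        (h (unit - b) - g ((↑(w unit)⁻¹ : E →L[ℝ] E) (unit - b))))) := by
  have hz := hs.alg'.inv_apply_mem hb.1 hx
  refine ((hs.tendsto_sub' ha hz).sub (hs.tendsto_sub' hb hz)).congr fun α => ?_
  rw [units_apply_inv]; ring

/-- The logarithmic function which describes the behaviour of `f` at the origin. -/
theorem exists_logarithmic (hs : IsSolution w w' f g h k) :
    ∃ (μ : E → ℝ) (c : ℝ),
    (∀ b ∈ cone E, Tendsto (fun α : ℝ => f (α • b) - f (α • unit)) (𝓝[>] 0) (𝓝 (μ b))) ∧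
    (∀ a ∈ cone E, ∀ b ∈ cone E,
      μ ((w' a : E →L[ℝ] E) ((↑(w' unit)⁻¹ : E →L[ℝ] E) b)) = μ a + μ b) ∧
    (∀ y ∈ D E, h y = g ((↑(w unit)⁻¹ : E →L[ℝ] E) y) + μ (unit - y) + c) ∧
    ContinuousOn μ (D E) ∧ ContinuousAt μ unit := by
  let η : E → ℝ := fun a => h (unit - a) - g ((↑(w unit)⁻¹ : E →L[ℝ] E) (unit - a))
  have hex : ∀ a ∈ cone E, ∃ m : ℝ, ∀ x ∈ cone E,
      Tendsto (fun α : ℝ => f (α • (w' a : E →L[ℝ] E) ((↑(w' unit)⁻¹ : E →L[ℝ] E) x)) - f (α • x))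
        (𝓝[>] 0) (𝓝 m) := by
    intro a ha
    -- Neither `a` nor the unit need lie in `D`; homogeneity makes `w'(a) w'(e)⁻¹` insensitive to
    -- scaling both arguments by a small `s`.
    obtain ⟨s, ⟨h1, h2⟩, h0⟩ := ((eventually_smul_mem_D ha).and
      (eventually_smul_mem_D (unit_mem_cone (E := E)))).and self_mem_nhdsWithin |>.exists
    have h0 : 0 < s := h0
    refine ⟨_, fun x hx => (hs.tendsto_ratio h1 h2 hx).congr fun α => ?_⟩
    have h3 := inv_apply_smul (hs.homogeneous' s h0 unit unit_mem_cone) x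
    rw [hs.homogeneous' s h0 a ha, smul_apply, ← h3, map_smul, map_smul]
  choose! μ hμ using hex
  have hlim : ∀ b ∈ cone E,
      Tendsto (fun α : ℝ => f (α • b) - f (α • unit)) (𝓝[>] 0) (𝓝 (μ b)) := by
    intro b hb
    have := hμ b hb unit unit_mem_cone
    rwa [hs.alg'.inv_apply_self unit_mem_cone, hs.alg'.apply_unit b hb] at this
  have hmul : ∀ a ∈ cone E, ∀ b ∈ cone E,
      μ ((w' a : E →L[ℝ] E) ((↑(w' unit)⁻¹ : E →L[ℝ] E) b)) = μ a + μ b := by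
    intro a ha b hb
    have h1 := hlim _ (hs.alg'.apply_mem ha (hs.alg'.inv_apply_mem unit_mem_cone hb))
    refine tendsto_nhds_unique h1 (((hμ a ha b hb).add (hlim b hb)).congr fun α => ?_)
    ring
  have hη : ∀ a ∈ D E, ∀ b ∈ D E, μ a - μ b = η a - η b := by
    intro a ha b hb
    have h1 := hs.tendsto_ratio ha hb hb.1
    rw [hs.alg'.inv_apply_self hb.1, hs.alg'.apply_unit a ha.1] at h1
    refine tendsto_nhds_unique (((hlim a ha.1).sub (hlim b hb.1)).congr fun α => ?_) h1
    ring
  have h2 : (1 / 2 : ℝ) • (unit : E) ∈ D E := smul_unit_mem_D (by norm_num) (by norm_num)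
  have hμη : ∀ a ∈ D E, μ a = η a + (μ ((1 / 2 : ℝ) • unit) - η ((1 / 2 : ℝ) • unit)) := by
    intro a ha
    linarith [hη a ha _ h2]
  have hηc : ContinuousOn η (D E) := by
    have hsub : ContinuousOn (fun a : E => unit - a) (D E) := by fun_prop
    have h3 : Set.MapsTo (fun a : E => unit - a) (D E) (D E) := fun a ha => unit_sub_mem_D ha
    refine (hs.cont_h.comp hsub h3).sub (hs.cont_g.comp
      ((↑(w unit)⁻¹ : E →L[ℝ] E).continuous.comp_continuousOn hsub) fun a ha => ?_)
    exact hs.alg.inv_apply_mem_D unit_mem_cone (h3 ha).1 (h3 ha).2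
  have hμc : ContinuousOn μ (D E) := (hηc.add continuousOn_const).congr hμη
  refine ⟨μ, η ((1 / 2 : ℝ) • unit) - μ ((1 / 2 : ℝ) • unit), hlim, hmul, ?_, hμc, ?_⟩
  · intro y hy
    have := hμη _ (unit_sub_mem_D hy)
    simp only [η, sub_sub_cancel] at this ⊢
    linarith
  · have h3 : ∀ b ∈ cone E, μ b = μ ((1 / 2 : ℝ) • b) - μ ((1 / 2 : ℝ) • unit) := by
      intro b hb
      have := hmul _ h2.1 b hb
      rw [hs.homogeneous' _ (by norm_num) unit unit_mem_cone, smul_apply, units_apply_inv] at this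
      linarith
    have h4 : ContinuousAt (fun b : E => μ ((1 / 2 : ℝ) • b) - μ ((1 / 2 : ℝ) • unit)) unit := by
      refine ContinuousAt.sub (ContinuousAt.comp (g := μ)
        (hμc.continuousAt (isOpen_D.mem_nhds h2)) (by fun_prop)) continuousAt_const
    refine h4.congr ?_
    filter_upwards [isOpen_cone.mem_nhds unit_mem_cone] with b hb
    exact (h3 b hb).symm

/-- Near the origin `f` and `k` differ, up to a convergent term, by a linear change of variable, so
invariance of either passes to the limit `μ`. For `k` the element `u` is conjugated by `w'(e)`. -/
theorem logarithmic_invariant (hs : IsSolution w w' f g h k) (hE : IsSimple E) {μ : E → ℝ}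
    (hlim : ∀ b ∈ cone E, Tendsto (fun α : ℝ => f (α • b) - f (α • unit)) (𝓝[>] 0) (𝓝 (μ b)))
    (hfk : IsInvariant f ∨ IsInvariant k) :
    ∀ u ∈ unitStabilizer E, ∀ b ∈ cone E, μ ((u : E →L[ℝ] E) b) = μ b := by
  intro u hu b hb
  have hub := mem_cone_of_mem_coneAut (unitStabilizer_le_coneAut E hu) hb
  rcases hfk with hf | hk
  · refine tendsto_nhds_unique_of_eventuallyEq (hlim _ hub) (hlim b hb) ?_
    filter_upwards [eventually_smul_mem_D hb] with α hα
    rw [← map_smul, hf u hu _ hα]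
  · have h2 : (1 / 2 : ℝ) • (unit : E) ∈ D E := smul_unit_mem_D (by norm_num) (by norm_num)
    have hw := hs.homogeneous' (1 / 2) (by norm_num) unit unit_mem_cone
    have hw' := hs.alg'.unit_mem hE
    let z : E → E := fun b => (2 : ℝ) • (↑(w' unit)⁻¹ : E →L[ℝ] E) b
    have hz : ∀ b ∈ cone E, z b ∈ cone E := fun b hb =>
      smul_mem_cone (hs.alg'.inv_apply_mem unit_mem_cone hb) two_pos
    have hzw : ∀ b, (w' ((1 / 2 : ℝ) • unit) : E →L[ℝ] E) (z b) = b := by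
      intro b
      simp only [z]
      rw [hw, smul_apply, map_smul, units_apply_inv, smul_smul]
      norm_num
    have h3 := hs.tendsto_sub' h2 (hz b hb)
    have h4 := hs.tendsto_sub' h2 (hz _ hub)
    rw [hzw] at h3 h4
    have h5 := (hlim _ hub).sub (hlim b hb)
    have h6 := h4.sub h3
    rw [sub_self] at h6
    rw [← sub_eq_zero]
    refine tendsto_nhds_unique_of_eventuallyEq h5 h6 ?_
    filter_upwards [eventually_smul_mem_D (hz b hb)] with α hα
    have h7 : α • z ((u : E →L[ℝ] E) b) =
        ((↑((w' unit)⁻¹ * u * w' unit) : E →L[ℝ] E)) (α • z b) := by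
      change _ = (↑(w' unit)⁻¹ : E →L[ℝ] E) ((u : E →L[ℝ] E) ((w' unit : E →L[ℝ] E) (α • z b)))
      simp only [z, map_smul, units_apply_inv]
    rw [h7, hk _ (mul_mem (mul_mem (inv_mem hw') hu) hw') _ hα]
    ring

/-- Both invariant functions are on the same side of the asymptotic relation, so it yields only the
invariance of `ν`. To reach `G = g ∘ w(e)⁻¹`, the increment `G(y) - G(sy)` is shown to be invariant,
and `s → 0` then compares `G` with `ν`. -/
theorem invariant_of_fst (hs : IsSolution w w' f g h k) (hE : IsSimple E) (hf : IsInvariant f) (hk : IsInvariant k) :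
    IsInvariant g ∧ IsInvariant h := by
  obtain ⟨μ, c, hlim, hmul, heq, hμc, hμe⟩ := hs.exists_logarithmic
  obtain ⟨ν, c', hlim', hmul', heq', hνc, hνe⟩ := hs.symm.exists_logarithmic
  have hμ := hs.logarithmic_invariant hE hlim (Or.inl hf)
  have hwu := hs.alg.unit_mem hE
  have hwu' := hs.alg'.unit_mem hE
  have hν : ∀ u ∈ unitStabilizer E, ∀ a ∈ D E, ν ((u : E →L[ℝ] E) a) = ν a := by
    intro u hu a ha
    have h1 := heq' _ (unit_sub_mem_D ha)
    have h2 := heq' _ (mem_D_of_mem_unitStabilizer hu (unit_sub_mem_D ha))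
    have h3 := (hk.comp (inv_mem hwu')) u hu _ (unit_sub_mem_D ha)
    simp only at h3
    rw [hf u hu _ (unit_sub_mem_D ha), h3] at h2
    have h4 : unit - (u : E →L[ℝ] E) (unit - a) = (u : E →L[ℝ] E) a := by
      rw [map_sub, hu.2, sub_sub_cancel]
    rw [h4] at h2
    rw [sub_sub_cancel] at h1
    linarith
  let G : E → ℝ := fun y => g ((↑(w unit)⁻¹ : E →L[ℝ] E) y)
  have hG : ∀ b ∈ cone E,
      Tendsto (fun α : ℝ => G (α • b) - G (α • unit)) (𝓝[>] 0) (𝓝 (ν b)) := by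
    intro b hb
    have h1 : ∀ b : E, Tendsto (fun α : ℝ => μ (unit - α • b)) (𝓝[>] 0) (𝓝 (μ unit)) :=
      fun b => hμe.tendsto.comp (tendsto_sub_smul unit b)
    have h2 := (hlim' b hb).sub ((h1 b).sub (h1 unit))
    rw [sub_self, sub_zero] at h2
    refine h2.congr' ?_
    filter_upwards [eventually_smul_mem_D hb, eventually_smul_mem_D (unit_mem_cone (E := E))]
      with α h3 h4
    rw [heq _ h3, heq _ h4]
    simp only [G]
    ring
  -- The equation at `((1 - s)e, sy)`: here `w(e - x) = s w(e)`, so the scaling of `y` cancels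
  -- inside `g`.
  have hdiff : ∀ y ∈ D E, ∀ s : ℝ, 0 < s → s < 1 → G y - G (s • y) = μ (unit - s • y) + c +
      k ((1 - s) • (↑(w' (unit - s • y))⁻¹ : E →L[ℝ] E) unit) - f ((1 - s) • unit) ∧
      (1 - s) • (↑(w' (unit - s • y))⁻¹ : E →L[ℝ] E) unit ∈ D E := by
    intro y hy s h0 h1
    have hsy := smul_mem_D hy h0 h1.le
    have hsub : unit - s • y - (1 - s) • unit = s • (unit - y) := by module
    have h2 : ((1 - s) • unit, s • y) ∈ D₀ E := by
      refine ⟨smul_unit_mem_D (by linarith) (by linarith), hsy,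
        add_mem_cone (smul_mem_cone unit_mem_cone (by linarith)) (cone_subset_squares hsy.1), ?_⟩
      rw [add_comm, ← sub_sub, hsub]
      exact smul_mem_cone hy.2 h0
    have h3 := hs.eq _ _ h2
    have h4 : unit - (1 - s) • (unit : E) = s • unit := by module
    rw [h4, inv_apply_smul (hs.homogeneous s h0 unit unit_mem_cone), heq _ hsy,
      map_smul (↑(w' (unit - s • y))⁻¹ : E →L[ℝ] E)] at h3
    refine ⟨by simp only [G]; linarith, ?_⟩
    rw [← map_smul]
    refine hs.alg'.inv_apply_mem_D hsy.2 (smul_mem_cone unit_mem_cone (by linarith)) ?_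
    rw [hsub]
    exact smul_mem_cone hy.2 h0
  have hGinv : IsInvariant G := by
    intro u hu y hy
    have huy := mem_D_of_mem_unitStabilizer hu hy
    have hstep : ∀ s : ℝ, 0 < s → s < 1 →
        G ((u : E →L[ℝ] E) y) - G y = G (s • (u : E →L[ℝ] E) y) - G (s • y) := by
      intro s h0 h1
      obtain ⟨e1, m1⟩ := hdiff y hy s h0 h1
      obtain ⟨e2, -⟩ := hdiff _ huy s h0 h1
      have hb := (smul_mem_D hy h0 h1.le).2
      have hub := mem_cone_of_mem_coneAut (unitStabilizer_le_coneAut E hu) hb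
      have e3 : unit - s • (u : E →L[ℝ] E) y = (u : E →L[ℝ] E) (unit - s • y) := by
        rw [map_sub, hu.2, map_smul]
      set b := unit - s • y
      -- This element fixes `e` and carries `w'(b)⁻¹ e` to `w'(ub)⁻¹ e`, so invariance of `k`
      -- absorbs the change of algorithm.
      have hv : (w' ((u : E →L[ℝ] E) b))⁻¹ * u * w' b ∈ unitStabilizer E := by
        refine hE.mem_unitStabilizer (mul_mem (mul_mem (inv_mem (hs.alg'.mem_G _ hub)) hu.1.1)
          (hs.alg'.mem_G _ hb)) ?_
        change (↑(w' ((u : E →L[ℝ] E) b))⁻¹ : E →L[ℝ] E)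
          ((u : E →L[ℝ] E) ((w' b : E →L[ℝ] E) unit)) = unit
        rw [hs.alg'.apply_unit b hb, hs.alg'.inv_apply_self hub]
      have e4 : (1 - s) • (↑(w' ((u : E →L[ℝ] E) b))⁻¹ : E →L[ℝ] E) unit =
          (↑((w' ((u : E →L[ℝ] E) b))⁻¹ * u * w' b) : E →L[ℝ] E)
            ((1 - s) • (↑(w' b)⁻¹ : E →L[ℝ] E) unit) := by
        change _ = (↑(w' ((u : E →L[ℝ] E) b))⁻¹ : E →L[ℝ] E)
          ((u : E →L[ℝ] E) ((w' b : E →L[ℝ] E) ((1 - s) • (↑(w' b)⁻¹ : E →L[ℝ] E) unit)))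
        simp only [map_smul, units_apply_inv, hu.2]
      rw [e3, e4, hk _ hv _ m1, hμ u hu b hb] at e2
      linarith
    have h1 := (hG _ huy.1).sub (hG y hy.1)
    rw [hν u hu y hy, sub_self] at h1
    rw [← sub_eq_zero]
    refine tendsto_nhds_unique_of_eventuallyEq tendsto_const_nhds h1 ?_
    have hα1 : ∀ᶠ α : ℝ in 𝓝[>] 0, α < 1 := nhdsWithin_le_nhds (gt_mem_nhds one_pos)
    filter_upwards [self_mem_nhdsWithin, hα1] with α h0 h1
    rw [hstep α h0 h1]; ring
  refine ⟨hGinv.of_comp (inv_mem hwu), fun u hu y hy => ?_⟩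
  rw [heq _ hy, heq _ (mem_D_of_mem_unitStabilizer hu hy)]
  have e1 := hGinv u hu y hy
  have e2 := hμ u hu _ hy.2
  rw [map_sub, hu.2] at e2
  simp only [G] at e1
  rw [e1, e2]

/-- Invariance of `h` or `g` makes `ν` invariant, and then `f(x) = k(w'(e)⁻¹ x) + ν(e - x) + c'`
transfers invariance between `f` and `k`. -/
theorem invariant_fst (hs : IsSolution w w' f g h k) (hE : IsSimple E) (h1 : IsInvariant f ∨ IsInvariant k)
    (h2 : IsInvariant h ∨ IsInvariant g) : IsInvariant f ∧ IsInvariant k := by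
  obtain ⟨ν, c', hlim', -, heq', -, -⟩ := hs.symm.exists_logarithmic
  have hν := hs.symm.logarithmic_invariant hE hlim' h2
  have hwu' := hs.alg'.unit_mem hE
  have hν' : ∀ u ∈ unitStabilizer E, ∀ x ∈ D E, ν (unit - (u : E →L[ℝ] E) x) = ν (unit - x) := by
    intro u hu x hx
    rw [← hν u hu _ hx.2, map_sub, hu.2]
  rcases h1 with hf | hk
  · refine ⟨hf, IsInvariant.of_comp (inv_mem hwu') fun u hu x hx => ?_⟩
    have e1 := heq' x hx
    have e2 := heq' _ (mem_D_of_mem_unitStabilizer hu hx)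
    rw [hν' u hu x hx, hf u hu x hx] at e2
    change k _ = k _
    linarith
  · refine ⟨fun u hu x hx => ?_, hk⟩
    rw [heq' x hx, heq' _ (mem_D_of_mem_unitStabilizer hu hx), hν' u hu x hx]
    have := (hk.comp (inv_mem hwu')) u hu x hx
    simp only at this
    rw [this]

theorem invariant_of_two (hs : IsSolution w w' f g h k) (hE : IsSimple E) (hinv : ∃ i j : Fin 4, i ≠ j ∧
      IsKInvariant (![f, g, h, k] i) ∧ IsKInvariant (![f, g, h, k] j)) :
    (IsInvariant f ∧ IsInvariant k) ∧ IsInvariant h ∧ IsInvariant g := by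
  have hmix : (IsInvariant f ∨ IsInvariant k) → (IsInvariant h ∨ IsInvariant g) →
      (IsInvariant f ∧ IsInvariant k) ∧ IsInvariant h ∧ IsInvariant g := fun h1 h2 =>
    ⟨hs.invariant_fst hE h1 h2, hs.symm.invariant_fst hE h2 h1⟩
  have hfk : IsInvariant f → IsInvariant k →
      (IsInvariant f ∧ IsInvariant k) ∧ IsInvariant h ∧ IsInvariant g := fun h1 h2 =>
    ⟨⟨h1, h2⟩, (hs.invariant_of_fst hE h1 h2).symm⟩
  have hhg : IsInvariant h → IsInvariant g →
      (IsInvariant f ∧ IsInvariant k) ∧ IsInvariant h ∧ IsInvariant g := fun h1 h2 =>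
    ⟨(hs.symm.invariant_of_fst hE h1 h2).symm, ⟨h1, h2⟩⟩
  obtain ⟨i, j, hij, hi, hj⟩ := hinv
  replace hi := hi.isInvariant
  replace hj := hj.isInvariant
  fin_cases i <;> fin_cases j <;> first | exact absurd rfl hij | skip
  · exact hmix (Or.inl hi) (Or.inr hj)
  · exact hmix (Or.inl hi) (Or.inl hj)
  · exact hfk hi hj
  · exact hmix (Or.inl hj) (Or.inr hi)
  · exact hhg hj hi
  · exact hmix (Or.inr hj) (Or.inr hi)
  · exact hmix (Or.inl hj) (Or.inl hi)
  · exact hhg hi hj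
  · exact hmix (Or.inr hj) (Or.inl hi)
  · exact hfk hj hi
  · exact hmix (Or.inr hi) (Or.inr hj)
  · exact hmix (Or.inr hi) (Or.inl hj)

end IsSolution

end Asymptotics

/-! ### Invariant functions on frames and the determinant -/

section Frames

variable {E : Type*} [NormedAddCommGroup E] [InnerProductSpace ℝ E] [EuclideanJordanAlgebra E]
  [FiniteDimensional ℝ E]

local infixl:70 " ⊙ " => EuclideanJordanAlgebra.mul

theorem IsCompleteSystem.jeval {r : ℕ} {c : Fin r → E} (hc : IsCompleteSystem c)
    (l : Fin r → ℝ) (p : Polynomial ℝ) :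
    jeval (∑ i, l i • c i) p = ∑ i, p.eval (l i) • c i := by
  rw [EuclideanJordanAlgebra.jeval, ← hc.sum_eq_unit, map_sum]
  refine Finset.sum_congr rfl fun i _ => ?_
  refine Module.End.aeval_apply_of_hasEigenvector
    ⟨Module.End.mem_eigenspace_iff.2 ?_, hc.ne_zero i⟩
  rw [mul_comm, hc.mul_sum]

/-- The value of a function at an element, computed from a spectral decomposition, does not depend
on the decomposition. -/
theorem IsCompleteSystem.sum_apply_smul_eq {r r' : ℕ} {c : Fin r → E} {c' : Fin r' → E}
    (hc : IsCompleteSystem c) (hc' : IsCompleteSystem c') {l : Fin r → ℝ} {l' : Fin r' → ℝ}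
    (h : ∑ i, l i • c i = ∑ i, l' i • c' i) (φ : ℝ → ℝ) :
    ∑ i, φ (l i) • c i = ∑ i, φ (l' i) • c' i := by
  classical
  let s : Finset ℝ := Finset.univ.image l ∪ Finset.univ.image l'
  let p : Polynomial ℝ := Lagrange.interpolate s id φ
  have hp : ∀ t ∈ s, p.eval t = φ t := fun t ht =>
    Lagrange.eval_interpolate_at_node (v := id) φ Function.injective_id.injOn ht
  have h1 := hc.jeval l p
  rw [h, hc'.jeval] at h1
  have h2 : ∀ i, p.eval (l i) = φ (l i) := fun i =>
    hp _ (Finset.mem_union_left _ (Finset.mem_image_of_mem _ (Finset.mem_univ i)))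
  have h3 : ∀ i, p.eval (l' i) = φ (l' i) := fun i =>
    hp _ (Finset.mem_union_right _ (Finset.mem_image_of_mem _ (Finset.mem_univ i)))
  simp only [h2, h3] at h1
  exact h1.symm

theorem IsCompleteSystem.inner_sum_unit {r : ℕ} {c : Fin r → E} (hc : IsCompleteSystem c)
    (l : Fin r → ℝ) : inner ℝ (∑ i, l i • c i) (unit : E) = ∑ i, l i * ‖c i‖ ^ 2 := by
  rw [sum_inner]
  refine Finset.sum_congr rfl fun i _ => ?_
  rw [real_inner_smul_left, ← real_inner_self_eq_norm_sq]
  congr 1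
  conv_lhs => rw [← hc.idem i]
  rw [← inner_mul, mul_unit]

theorem IsSimple.pos_of_completeSystem (hE : IsSimple E) {r : ℕ} {c : Fin r → E}
    (hc : IsCompleteSystem c) : 0 < r := by
  have := hE.nontrivial
  rcases Nat.eq_zero_or_pos r with rfl | h
  · exfalso
    have hu : (unit : E) = 0 := by rw [← hc.sum_eq_unit]; simp
    obtain ⟨z, hz⟩ := exists_ne (0 : E)
    exact hz (by rw [← mul_unit z, hu, map_zero])
  · exact h

/-- The element `log x` does not depend on the decomposition, and `⟨log x, e⟩` is the sum of the
logarithms times the common value of `‖c i‖²`. Hence the chosen value in `det` is the right one. -/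
theorem IsSimple.log_det (hE : IsSimple E) {r : ℕ} {c : Fin r → E} (hc : IsCompleteSystem c)
    {l : Fin r → ℝ} (hl : ∀ i, 0 < l i) :
    Real.log (det (∑ i, l i • c i)) = ∑ i, Real.log (l i) := by
  have hx : ∃ d, IsDet (∑ i, l i • c i) d := ⟨_, r, c, l, hc, rfl, rfl⟩
  rw [det, dif_pos hx]
  obtain ⟨r', c', l', hc', hxx, hd⟩ := hx.choose_spec
  rw [hd]
  have hl' : ∀ i, 0 < l' i := by
    rw [← sum_mem_cone_iff hc', ← hxx, sum_mem_cone_iff hc]; exact hl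
  rw [Real.log_prod fun i _ => (hl' i).ne']
  have h1 := congrArg (fun z : E => inner ℝ z (unit : E)) (hc.sum_apply_smul_eq hc' hxx Real.log)
  simp only [hc.inner_sum_unit, hc'.inner_sum_unit] at h1
  have hr : 0 < r := hE.pos_of_completeSystem hc
  let i₀ : Fin r := ⟨0, hr⟩
  have e1 : ∀ i, ‖c i‖ = ‖c i₀‖ := fun i => hE.norm_eq (hc.primitive i) (hc.primitive i₀)
  have e2 : ∀ i, ‖c' i‖ = ‖c i₀‖ := fun i => hE.norm_eq (hc'.primitive i) (hc.primitive i₀)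
  simp only [e1, e2, ← Finset.sum_mul] at h1
  exact (mul_right_cancel₀ (pow_ne_zero 2 (norm_ne_zero_iff.2 (hc.ne_zero i₀))) h1).symm

theorem IsSimple.exists_completeSystem (hE : IsSimple E) :
    ∃ (r : ℕ) (c : Fin r → E), IsCompleteSystem c ∧ 0 < r := by
  obtain ⟨r, c, l, hc, -⟩ := exists_spectral (unit : E)
  exact ⟨r, c, hc, hE.pos_of_completeSystem hc⟩

/-- The element with given eigenvalues along a frame. -/
def diag {r : ℕ} (c : Fin r → E) (l : Fin r → ℝ) : E := ∑ i, l i • c i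

theorem diag_one {r : ℕ} {c : Fin r → E} (hc : IsCompleteSystem c) : diag c 1 = unit := by
  simp [diag, hc.sum_eq_unit]

theorem diag_add {r : ℕ} (c : Fin r → E) (a b : Fin r → ℝ) :
    diag c (a + b) = diag c a + diag c b := by
  simp [diag, add_smul, Finset.sum_add_distrib]

theorem diag_sub {r : ℕ} (c : Fin r → E) (a b : Fin r → ℝ) :
    diag c (a - b) = diag c a - diag c b := by
  simp [diag, sub_smul, Finset.sum_sub_distrib]

theorem unit_sub_diag {r : ℕ} {c : Fin r → E} (hc : IsCompleteSystem c) (a : Fin r → ℝ) :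
    unit - diag c a = diag c (1 - a) := by
  rw [diag_sub, diag_one hc]

theorem continuous_diag {r : ℕ} (c : Fin r → E) : Continuous (diag c) := by
  unfold diag; fun_prop

theorem diag_mem_cone {r : ℕ} {c : Fin r → E} (hc : IsCompleteSystem c) {a : Fin r → ℝ}
    (ha : ∀ i, 0 < a i) : diag c a ∈ cone E := (sum_mem_cone_iff hc).2 ha

theorem diag_mem_D_iff {r : ℕ} {c : Fin r → E} (hc : IsCompleteSystem c) {a : Fin r → ℝ} :
    diag c a ∈ D E ↔ a ∈ unitBox (Fin r) := by
  rw [D, Set.mem_ofPred_eq, unit_sub_diag hc, diag, diag, sum_mem_cone_iff hc,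
    sum_mem_cone_iff hc, unitBox, Set.mem_ofPred_eq, forall_and]
  simp

/-- The automorphism of the cone which acts on a frame by scaling. -/
theorem exists_scaling {r : ℕ} {c : Fin r → E} (hc : IsCompleteSystem c) {v : Fin r → ℝ}
    (hv : ∀ i, 0 < v i) : ∃ A ∈ G E, ∀ a : Fin r → ℝ,
      (A : E →L[ℝ] E) (diag c a) = diag c (v * a) := by
  refine ⟨_, (isTangent_mulL (∑ i, Real.log (v i) • c i)).expUnit_mem_G, fun a => ?_⟩
  rw [expUnit_val, diag, diag, map_sum]
  refine Finset.sum_congr rfl fun i _ => ?_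
  have : mulL (∑ i, Real.log (v i) • c i) (c i) = Real.log (v i) • c i := by
    rw [mulL_apply, mul_comm, hc.mul_sum]
  rw [map_smul, exp_apply_of_eigen this, Real.exp_log (hv i), smul_smul, Pi.mul_apply,
    _root_.mul_comm]

/-- Any element of `G` sending `e` to `diag c v` differs from the frame scaling by an element fixing
`e`, which an invariant function does not see. -/
theorem IsInvariant.inv_apply_diag {φ : E → ℝ} (hE : IsSimple E) (hφ : IsInvariant φ) {r : ℕ}
    {c : Fin r → E} (hc : IsCompleteSystem c) {v a : Fin r → ℝ} (hv : ∀ i, 0 < v i)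
    (ha : a / v ∈ unitBox (Fin r)) {T : (E →L[ℝ] E)ˣ} (hT : T ∈ G E)
    (hTe : (T : E →L[ℝ] E) unit = diag c v) :
    φ ((↑T⁻¹ : E →L[ℝ] E) (diag c a)) = φ (diag c (a / v)) := by
  obtain ⟨A, hA, hAd⟩ := exists_scaling hc hv
  have hu : T⁻¹ * A ∈ unitStabilizer E := by
    refine hE.mem_unitStabilizer (mul_mem (inv_mem hT) hA) ?_
    change (↑T⁻¹ : E →L[ℝ] E) ((A : E →L[ℝ] E) unit) = unit
    rw [← diag_one hc, hAd, mul_one, ← hTe, units_inv_apply, diag_one hc]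
  have h1 := hφ _ hu _ ((diag_mem_D_iff hc).2 ha)
  change φ ((↑T⁻¹ : E →L[ℝ] E) ((A : E →L[ℝ] E) (diag c (a / v)))) = _ at h1
  rw [hAd] at h1
  have : v * (a / v) = a := by
    ext i; simp only [Pi.mul_apply, Pi.div_apply]; field_simp [(hv i).ne']
  rwa [this] at h1

/-- A continuous invariant function takes the same values at corresponding points of the lines
spanned by the unit and two primitive idempotents. -/
theorem IsInvariant.eq_of_primitive {φ : E → ℝ} (hE : IsSimple E) (hφ : IsInvariant φ)
    (hcont : ContinuousOn φ (D E)) {c d : E} (hc : IsPrimitive c) (hd : IsPrimitive d)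
    {s t : ℝ} (hcD : s • unit + t • c ∈ D E) (hdD : s • unit + t • d ∈ D E) :
    φ (s • unit + t • d) = φ (s • unit + t • c) := by
  have hmem := hE.mem_closure_orbit hc hd
  have : (𝓝[orbit c] d).NeBot := mem_closure_iff_nhdsWithin_neBot.1 hmem
  have hP : ContinuousAt (fun x : E => s • unit + t • x) d := by fun_prop
  have h1 : ContinuousAt (fun x : E => φ (s • unit + t • x)) d :=
    ContinuousAt.comp (g := φ) (hcont.continuousAt (isOpen_D.mem_nhds hdD)) hP
  refine tendsto_nhds_unique_of_eventuallyEq (h1.tendsto.mono_left nhdsWithin_le_nhds)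
    (tendsto_const_nhds (f := 𝓝[orbit c] d)) ?_
  filter_upwards [self_mem_nhdsWithin] with x hx
  obtain ⟨u, hu, rfl⟩ := hx
  rw [← hφ u hu _ hcD, map_add, map_smul, map_smul, hu.2]

/-- Points `s e + t c i` with one exceptional eigenvalue determine each coefficient and the
constant. Comparing them needs only transitivity on single primitive idempotents, not on frames. -/
theorem eq_log_det_of_eq_logSum {φ : E → ℝ} (hE : IsSimple E) (hφ : IsInvariant φ)
    (hcont : ContinuousOn φ (D E))
    (hlog : ∀ (r : ℕ) (c : Fin r → E), IsCompleteSystem c → ∃ (κ : Fin r → ℝ) (C : ℝ),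
      ∀ a ∈ unitBox (Fin r), φ (diag c a) = logSum κ a + C) :
    ∃ κ C : ℝ, ∀ x ∈ D E, φ x = κ * Real.log (det x) + C := by
  obtain ⟨r₀, c₀, hc₀, hr₀⟩ := hE.exists_completeSystem
  obtain ⟨κ₀, C₀, h₀⟩ := hlog r₀ c₀ hc₀
  let i₀ : Fin r₀ := ⟨0, hr₀⟩
  have hpt : ∀ (r : ℕ) (c : Fin r → E), IsCompleteSystem c → ∀ (i : Fin r) (s t : ℝ),
      s • unit + t • c i = diag c (fun j => s + if j = i then t else 0) := by
    intro r c hc i s t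
    rw [hc.smul_unit, diag]
    simp only [add_smul, Finset.sum_add_distrib, ite_smul, zero_smul, Finset.sum_ite_eq',
      Finset.mem_univ, if_true]
  have hsum : ∀ (r : ℕ) (κ : Fin r → ℝ) (i : Fin r) (m n : ℝ),
      logSum κ (fun j => Real.exp m + if j = i then Real.exp n - Real.exp m else 0) =
        (∑ j, κ j) * m + κ i * (n - m) := by
    intro r κ i m n
    have : ∀ j, Real.log (Real.exp m + if j = i then Real.exp n - Real.exp m else 0) =
        m + if j = i then n - m else 0 := by
      intro j
      split_ifs <;> simp
    simp only [logSum, this, mul_add, mul_ite, mul_zero, Finset.sum_add_distrib,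
      Finset.sum_ite_eq', Finset.mem_univ, if_true, Finset.sum_mul]
  have hbox : ∀ (r : ℕ) (i : Fin r) (m n : ℝ), m < 0 → n < 0 →
      (fun j => Real.exp m + if j = i then Real.exp n - Real.exp m else 0) ∈ unitBox (Fin r) := by
    intro r i m n hm hn j
    dsimp only
    split_ifs
    · rw [add_sub_cancel]; exact ⟨Real.exp_pos _, by rw [← Real.exp_zero]; exact Real.exp_lt_exp.2 hn⟩
    · rw [add_zero]; exact ⟨Real.exp_pos _, by rw [← Real.exp_zero]; exact Real.exp_lt_exp.2 hm⟩
  have hcomp : ∀ (r : ℕ) (c : Fin r → E) (hc : IsCompleteSystem c) (κ : Fin r → ℝ) (C : ℝ),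
      (∀ a ∈ unitBox (Fin r), φ (diag c a) = logSum κ a + C) → ∀ (i : Fin r) (m n : ℝ),
      m < 0 → n < 0 → (∑ j, κ j) * m + κ i * (n - m) + C =
        (∑ j, κ₀ j) * m + κ₀ i₀ * (n - m) + C₀ := by
    intro r c hc κ C h i m n hm hn
    have h1 := h _ (hbox r i m n hm hn)
    have h2 := h₀ _ (hbox r₀ i₀ m n hm hn)
    rw [hsum] at h1 h2
    rw [← h1, ← h2]
    have h3 := (diag_mem_D_iff hc).2 (hbox r i m n hm hn)
    have h4 := (diag_mem_D_iff hc₀).2 (hbox r₀ i₀ m n hm hn)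
    rw [← hpt r c hc] at h3 ⊢
    rw [← hpt r₀ c₀ hc₀] at h4 ⊢
    exact hφ.eq_of_primitive hE hcont (hc₀.primitive i₀) (hc.primitive i) h4 h3
  refine ⟨κ₀ i₀, C₀, fun x hx => ?_⟩
  obtain ⟨r, c, l, hc, rfl⟩ := exists_spectral x
  obtain ⟨κ, C, h⟩ := hlog r c hc
  have hl : l ∈ unitBox (Fin r) := (diag_mem_D_iff hc).1 hx
  -- The three pairs of log-eigenvalues separate `κ i`, the sum of the `κ j` and the constant.
  have e1 := fun i => hcomp r c hc κ C h i (-1) (-1) (by norm_num) (by norm_num)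
  have e2 := fun i => hcomp r c hc κ C h i (-1) (-2) (by norm_num) (by norm_num)
  have e3 := fun i => hcomp r c hc κ C h i (-2) (-1) (by norm_num) (by norm_num)
  have hr : 0 < r := hE.pos_of_completeSystem hc
  have hκ : ∀ i, κ i = κ₀ i₀ := fun i => by linarith [e1 i, e2 i]
  have hC : C = C₀ := by
    have := hκ ⟨0, hr⟩
    linarith [e1 ⟨0, hr⟩, e2 ⟨0, hr⟩, e3 ⟨0, hr⟩]
  rw [hE.log_det hc fun i => (hl i).1]
  have := h l hl
  simp only [diag, logSum, hκ, ← Finset.mul_sum] at this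
  rw [this, hC]

variable {w : E → (E →L[ℝ] E)ˣ}

theorem exists_logSum_of_logarithmic (hE : IsSimple E) (hw : IsMultiplicationAlgorithm w)
    {μ : E → ℝ} (hmul : ∀ a ∈ cone E, ∀ b ∈ cone E,
      μ ((w a : E →L[ℝ] E) ((↑(w unit)⁻¹ : E →L[ℝ] E) b)) = μ a + μ b)
    (hinv : ∀ u ∈ unitStabilizer E, ∀ b ∈ cone E, μ ((u : E →L[ℝ] E) b) = μ b)
    (hcont : ContinuousAt μ unit) {r : ℕ} {c : Fin r → E} (hc : IsCompleteSystem c) :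
    ∃ κ : Fin r → ℝ, ∀ a : Fin r → ℝ, (∀ i, 0 < a i) → μ (diag c a) = logSum κ a := by
  refine exists_eq_logSum (L := fun a => μ (diag c a)) ?_ fun v a hv ha => ?_
  · refine ContinuousAt.comp (g := μ) ?_ (continuous_diag c).continuousAt
    rwa [diag_one hc]
  · obtain ⟨A, hA, hAd⟩ := exists_scaling hc hv
    have hva := diag_mem_cone hc hv
    have hb := diag_mem_cone hc ha
    -- Replacing `b` by its image under this element turns `w(diag c v) w(e)⁻¹ b` into the frame
    -- scaling, that is, coordinatewise multiplication.
    have hu : w unit * (w (diag c v))⁻¹ * A ∈ unitStabilizer E := by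
      refine hE.mem_unitStabilizer (mul_mem (mul_mem (hw.mem_G _ unit_mem_cone)
        (inv_mem (hw.mem_G _ hva))) hA) ?_
      change (w unit : E →L[ℝ] E) ((↑(w (diag c v))⁻¹ : E →L[ℝ] E) ((A : E →L[ℝ] E) unit)) = unit
      rw [← diag_one hc, hAd, mul_one, hw.inv_apply_self hva, diag_one hc,
        hw.apply_unit _ unit_mem_cone]
    have h1 := hmul _ hva _ (mem_cone_of_mem_coneAut (unitStabilizer_le_coneAut E hu) hb)
    rw [hinv _ hu _ hb] at h1
    change μ ((w (diag c v) : E →L[ℝ] E) ((↑(w unit)⁻¹ : E →L[ℝ] E)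
      ((w unit : E →L[ℝ] E) ((↑(w (diag c v))⁻¹ : E →L[ℝ] E)
        ((A : E →L[ℝ] E) (diag c a)))))) = _ at h1
    rw [units_inv_apply, units_apply_inv, hAd] at h1
    exact h1

end Frames

/-! ### Solving the invariant equation -/

section Solution

variable {E : Type*} [NormedAddCommGroup E] [InnerProductSpace ℝ E] [EuclideanJordanAlgebra E]
  [FiniteDimensional ℝ E] {w w' : E → (E →L[ℝ] E)ˣ} {f g h k : E → ℝ}

theorem IsSimple.log_det_smul_unit (hE : IsSimple E) :
    ∃ r : ℕ, ∀ t : ℝ, 0 < t → Real.log (det (t • (unit : E))) = r * Real.log t := by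
  obtain ⟨r, c, hc, -⟩ := hE.exists_completeSystem
  refine ⟨r, fun t ht => ?_⟩
  rw [hc.smul_unit, hE.log_det hc fun _ => ht]
  simp

theorem isInvariant_comp_unit_sub {φ : E → ℝ} (hφ : IsInvariant φ) :
    IsInvariant fun x => φ (unit - x) := by
  intro u hu x hx
  have := hφ u hu _ (unit_sub_mem_D hx)
  rwa [map_sub, hu.2] at this

theorem IsInvariant.sub {φ ψ : E → ℝ} (hφ : IsInvariant φ) (hψ : IsInvariant ψ) :
    IsInvariant fun x => φ x - ψ x := fun u hu x hx => by
  simp only [hφ u hu x hx, hψ u hu x hx]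

theorem continuousOn_comp_unit_sub {φ : E → ℝ} (hφ : ContinuousOn φ (D E)) :
    ContinuousOn (fun x => φ (unit - x)) (D E) :=
  hφ.comp (by fun_prop) fun _ hx => unit_sub_mem_D hx

/-- Eliminating `f` and `h` leaves the terms `ν(a)` and `μ(b)`. Subtracting `μ` from `k` and `ν`
from `g` absorbs them, because `logSum` turns the quotients `(1-b)/a` and `(1-a)/b` into
differences. -/
theorem IsSolution.equation_of_invariant (hs : IsSolution w w' f g h k) (hE : IsSimple E)
    (hg : IsInvariant g) (hk : IsInvariant k) {μ ν : E → ℝ} {c₁ c₂ : ℝ}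
    (hfk : ∀ x ∈ D E, f x = k x + ν (unit - x) + c₂)
    (hhg : ∀ y ∈ D E, h y = g y + μ (unit - y) + c₁)
    {r : ℕ} {c : Fin r → E} (hc : IsCompleteSystem c) {κ κ' : Fin r → ℝ}
    (hμ : ∀ a : Fin r → ℝ, (∀ i, 0 < a i) → μ (diag c a) = logSum κ a)
    (hν : ∀ a : Fin r → ℝ, (∀ i, 0 < a i) → ν (diag c a) = logSum κ' a)
    {a b : Fin r → ℝ} (ha : a ∈ unitBox (Fin r)) (hb : b ∈ unitBox (Fin r))
    (hab : ∀ i, 1 < a i + b i) :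
    (k (diag c (1 - a)) - μ (diag c (1 - a))) +
        (g (diag c (1 - (a + b - 1) / a)) - ν (diag c (1 - (a + b - 1) / a))) =
      (g (diag c (1 - b)) - ν (diag c (1 - b))) +
        (k (diag c (1 - (a + b - 1) / b)) - μ (diag c (1 - (a + b - 1) / b))) + (c₁ - c₂) := by
  have ha' : ∀ i, 0 < a i := fun i => (ha i).1
  have hb' : ∀ i, 0 < b i := fun i => (hb i).1
  have hcompl : ∀ a ∈ unitBox (Fin r), 1 - a ∈ unitBox (Fin r) := fun a ha i =>
    ⟨sub_pos.2 (ha i).2, by simpa using (ha i).1⟩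
  have hX := hcompl a ha
  have hY := hcompl b hb
  have e1 : 1 - (a + b - 1) / a = (1 - b) / a := by
    ext i
    have := ha' i
    simp only [Pi.sub_apply, Pi.div_apply, Pi.add_apply, Pi.one_apply]
    field_simp
    ring
  have e2 : 1 - (a + b - 1) / b = (1 - a) / b := by
    ext i
    have := hb' i
    simp only [Pi.sub_apply, Pi.div_apply, Pi.add_apply, Pi.one_apply]
    field_simp
    ring
  have hYa : (1 - b) / a ∈ unitBox (Fin r) := fun i =>
    ⟨div_pos (hY i).1 (ha' i), (div_lt_one (ha' i)).2 (by
      have := hab i; simp only [Pi.sub_apply, Pi.one_apply]; linarith)⟩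
  have hXb : (1 - a) / b ∈ unitBox (Fin r) := fun i =>
    ⟨div_pos (hX i).1 (hb' i), (div_lt_one (hb' i)).2 (by
      have := hab i; simp only [Pi.sub_apply, Pi.one_apply]; linarith)⟩
  have hD₀ : (diag c (1 - a), diag c (1 - b)) ∈ D₀ E := by
    refine ⟨(diag_mem_D_iff hc).2 hX, (diag_mem_D_iff hc).2 hY, ?_⟩
    change diag c (1 - a) + diag c (1 - b) ∈ D E
    rw [← diag_add, diag_mem_D_iff hc]
    intro i
    have h1 := (hX i).1
    have h2 := (hY i).1
    have h3 := hab i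
    simp only [Pi.add_apply, Pi.sub_apply, Pi.one_apply] at h1 h2 ⊢
    constructor <;> linarith
  have key := hs.eq _ _ hD₀
  rw [unit_sub_diag hc, unit_sub_diag hc, sub_sub_cancel, sub_sub_cancel] at key
  have hwa := hs.alg.mem_G _ (diag_mem_cone hc ha')
  have hwb := hs.alg'.mem_G _ (diag_mem_cone hc hb')
  rw [hg.inv_apply_diag hE hc ha' hYa hwa (hs.alg.apply_unit _ (diag_mem_cone hc ha')),
    hk.inv_apply_diag hE hc hb' hXb hwb (hs.alg'.apply_unit _ (diag_mem_cone hc hb')),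
    hfk _ ((diag_mem_D_iff hc).2 hX), hhg _ ((diag_mem_D_iff hc).2 hY),
    unit_sub_diag hc, unit_sub_diag hc, sub_sub_cancel, sub_sub_cancel, hμ b hb', hν a ha'] at key
  rw [e1, e2, hμ _ fun i => (hX i).1, hμ _ fun i => (hXb i).1, hν _ fun i => (hY i).1,
    hν _ fun i => (hYa i).1, logSum_div _ (fun i => (hX i).1) hb',
    logSum_div _ (fun i => (hY i).1) ha']
  linarith

/-- The invariant solutions of the functional equation. -/
theorem IsSolution.eq_log_det (hs : IsSolution w w' f g h k) (hE : IsSimple E)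
    (hf : IsInvariant f) (hg : IsInvariant g) (hh : IsInvariant h) (hk : IsInvariant k) :
    ∃ κ₁ κ₂ κ₃ C₁ C₂ C₃ C₄ : ℝ, ∀ x ∈ D E,
      f x = κ₁ * Real.log (det (unit - x)) + κ₂ * Real.log (det x) +
        κ₃ * Real.log (det (unit - x)) + C₁ ∧
      g x = κ₁ * Real.log (det (unit - x)) + κ₃ * Real.log (det x) + C₂ ∧
      h x = κ₁ * Real.log (det (unit - x)) + κ₂ * Real.log (det (unit - x)) +
        κ₃ * Real.log (det x) + C₃ ∧
      k x = κ₁ * Real.log (det (unit - x)) + κ₂ * Real.log (det x) + C₄ := by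
  obtain ⟨μ, c₁, hlim, hmul, heq, hμc, hμe⟩ := hs.exists_logarithmic
  obtain ⟨ν, c₂, hlim', hmul', heq', hνc, hνe⟩ := hs.symm.exists_logarithmic
  have hμi := hs.logarithmic_invariant hE hlim (Or.inl hf)
  have hνi := hs.symm.logarithmic_invariant hE hlim' (Or.inl hh)
  have hμI : IsInvariant μ := fun u hu x hx => hμi u hu x hx.1
  have hνI : IsInvariant ν := fun u hu x hx => hνi u hu x hx.1
  have hfk : ∀ x ∈ D E, f x = k x + ν (unit - x) + c₂ := fun x hx => by
    rw [heq' x hx, hk _ (inv_mem (hs.alg'.unit_mem hE)) x hx]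
  have hhg : ∀ y ∈ D E, h y = g y + μ (unit - y) + c₁ := fun y hy => by
    rw [heq y hy, hg _ (inv_mem (hs.alg.unit_mem hE)) y hy]
  have hμl := fun (r : ℕ) (c : Fin r → E) (hc : IsCompleteSystem c) =>
    exists_logSum_of_logarithmic hE hs.alg' hmul hμi hμe hc
  have hνl := fun (r : ℕ) (c : Fin r → E) (hc : IsCompleteSystem c) =>
    exists_logSum_of_logarithmic hE hs.alg hmul' hνi hνe hc
  let p : E → ℝ := fun x => k (unit - x) - μ (unit - x)
  let q : E → ℝ := fun x => g (unit - x) - ν (unit - x)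
  have hpc : ContinuousOn p (D E) :=
    (continuousOn_comp_unit_sub hs.cont_k).sub (continuousOn_comp_unit_sub hμc)
  have hqc : ContinuousOn q (D E) :=
    (continuousOn_comp_unit_sub hs.cont_g).sub (continuousOn_comp_unit_sub hνc)
  have hpI : IsInvariant p := (isInvariant_comp_unit_sub hk).sub (isInvariant_comp_unit_sub hμI)
  have hpq : ∀ (r : ℕ) (c : Fin r → E), IsCompleteSystem c → ∃ (κ : Fin r → ℝ) (C C' : ℝ),
      ∀ a ∈ unitBox (Fin r), p (diag c a) = logSum κ a + C ∧ q (diag c a) = logSum κ a + C' := by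
    intro r c hc
    obtain ⟨κ, hκ⟩ := hμl r c hc
    obtain ⟨κ', hκ'⟩ := hνl r c hc
    have hmaps : Set.MapsTo (diag c) (unitBox (Fin r)) (D E) := fun a ha =>
      (diag_mem_D_iff hc).2 ha
    refine eq_logSum_of_equation (c := c₁ - c₂)
      (hpc.comp (continuous_diag c).continuousOn hmaps)
      (hqc.comp (continuous_diag c).continuousOn hmaps) fun a ha b hb hab => ?_
    simp only [p, q, unit_sub_diag hc]
    exact hs.equation_of_invariant hE hg hk hfk hhg hc hκ hκ' ha hb hab
  obtain ⟨κ₁, Cp, hp⟩ := eq_log_det_of_eq_logSum hE hpI hpc fun r c hc => by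
    obtain ⟨κ, C, C', h1⟩ := hpq r c hc
    exact ⟨κ, C, fun a ha => (h1 a ha).1⟩
  obtain ⟨κ₂, Cμ, hμ⟩ := eq_log_det_of_eq_logSum hE hμI hμc fun r c hc => by
    obtain ⟨κ, h1⟩ := hμl r c hc
    exact ⟨κ, 0, fun a ha => by rw [h1 a fun i => (ha i).1, add_zero]⟩
  obtain ⟨κ₃, Cν, hν⟩ := eq_log_det_of_eq_logSum hE hνI hνc fun r c hc => by
    obtain ⟨κ, h1⟩ := hνl r c hc
    exact ⟨κ, 0, fun a ha => by rw [h1 a fun i => (ha i).1, add_zero]⟩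
  -- On each frame `p` and `q` have the same coefficients; evaluating at `e/2`, which lies on every
  -- frame, makes the additive difference independent of the frame.
  have hq : ∀ x ∈ D E, q x =
      p x + (q ((1 / 2 : ℝ) • unit) - p ((1 / 2 : ℝ) • unit)) := by
    intro x hx
    obtain ⟨r, c, l, hc, rfl⟩ := exists_spectral x
    obtain ⟨κ, C, C', h1⟩ := hpq r c hc
    obtain ⟨e1, e2⟩ := h1 l ((diag_mem_D_iff hc).1 hx)
    have hhalf : (1 / 2 : ℝ) • (unit : E) = diag c fun _ => 1 / 2 := hc.smul_unit _
    obtain ⟨e3, e4⟩ := h1 (fun _ => 1 / 2) fun _ => by norm_num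
    rw [hhalf, e3, e4]
    change q (diag c l) = p (diag c l) + _
    rw [e1, e2]; ring
  set δ := q ((1 / 2 : ℝ) • unit) - p ((1 / 2 : ℝ) • unit)
  refine ⟨κ₁, κ₂, κ₃, Cp + Cμ + Cν + c₂, Cp + δ + Cν, Cp + δ + Cν + Cμ + c₁, Cp + Cμ,
    fun x hx => ?_⟩
  have hx' := unit_sub_mem_D hx
  have ek := hp _ hx'
  have eg := hq _ hx'
  rw [ek] at eg
  simp only [p, q, sub_sub_cancel] at ek eg
  rw [hfk x hx, hhg x hx]
  have e1 := hμ x hx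
  have e2 := hμ _ hx'
  have e3 := hν x hx
  have e4 := hν _ hx'
  refine ⟨?_, ?_, ?_, ?_⟩ <;> linarith

end Solution

end EuclideanJordanAlgebra

theorem corollary3p10 {E : Type*} [NormedAddCommGroup E] [InnerProductSpace ℝ E]
    [FiniteDimensional ℝ E] [EuclideanJordanAlgebra E]
    (hE : EuclideanJordanAlgebra.IsSimple E)
    (w w' : E → (E →L[ℝ] E)ˣ)
    (hw : EuclideanJordanAlgebra.IsMultiplicationAlgorithm w)
    (hw' : EuclideanJordanAlgebra.IsMultiplicationAlgorithm w')
    (hwABC : EuclideanJordanAlgebra.SatisfiesABC w)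
    (hwABC' : EuclideanJordanAlgebra.SatisfiesABC w')
    (f g h k : E → ℝ)
    (hf : ContinuousOn f (EuclideanJordanAlgebra.D E))
    (hg : ContinuousOn g (EuclideanJordanAlgebra.D E))
    (hh : ContinuousOn h (EuclideanJordanAlgebra.D E))
    (hk : ContinuousOn k (EuclideanJordanAlgebra.D E))
    (heq : ∀ x y : E, (x, y) ∈ EuclideanJordanAlgebra.D₀ E →
      f x + g ((((w (EuclideanJordanAlgebra.unit - x))⁻¹ : (E →L[ℝ] E)ˣ) : E →L[ℝ] E) y) =
      h y + k ((((w' (EuclideanJordanAlgebra.unit - y))⁻¹ : (E →L[ℝ] E)ˣ) : E →L[ℝ] E) x))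
    (hinv : ∃ i j : Fin 4, i ≠ j ∧
      EuclideanJordanAlgebra.IsKInvariant (![f, g, h, k] i) ∧
      EuclideanJordanAlgebra.IsKInvariant (![f, g, h, k] j)) :
    ∃ κ₁ κ₂ κ₃ C₁ C₂ C₃ C₄ : ℝ, C₁ + C₂ = C₃ + C₄ ∧
      ∀ x ∈ EuclideanJordanAlgebra.D E,
        f x = κ₁ * Real.log (EuclideanJordanAlgebra.det (EuclideanJordanAlgebra.unit - x)) +
          κ₂ * Real.log (EuclideanJordanAlgebra.det x) +
          κ₃ * Real.log (EuclideanJordanAlgebra.det (EuclideanJordanAlgebra.unit - x)) + C₁ ∧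
        g x = κ₁ * Real.log (EuclideanJordanAlgebra.det (EuclideanJordanAlgebra.unit - x)) +
          κ₃ * Real.log (EuclideanJordanAlgebra.det x) + C₂ ∧
        h x = κ₁ * Real.log (EuclideanJordanAlgebra.det (EuclideanJordanAlgebra.unit - x)) +
          κ₂ * Real.log (EuclideanJordanAlgebra.det (EuclideanJordanAlgebra.unit - x)) +
          κ₃ * Real.log (EuclideanJordanAlgebra.det x) + C₃ ∧
        k x = κ₁ * Real.log (EuclideanJordanAlgebra.det (EuclideanJordanAlgebra.unit - x)) +
          κ₂ * Real.log (EuclideanJordanAlgebra.det x) + C₄ := by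
  open EuclideanJordanAlgebra in
  have hs : IsSolution w w' f g h k := ⟨hw, hw', hwABC.homogeneous, hwABC'.homogeneous,
    hwABC.continuous_at_unit, hwABC'.continuous_at_unit, hf, hg, hh, hk, heq⟩
  obtain ⟨⟨hfI, hkI⟩, hhI, hgI⟩ := hs.invariant_of_two hE hinv
  obtain ⟨κ₁, κ₂, κ₃, C₁, C₂, C₃, C₄, hC⟩ := hs.eq_log_det hE hfI hgI hhI hkI
  refine ⟨κ₁, κ₂, κ₃, C₁, C₂, C₃, C₄, ?_, hC⟩
  obtain ⟨r, hr⟩ := hE.log_det_smul_unit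
  have h3 : (1 / 3 : ℝ) • (unit : E) ∈ D E := smul_unit_mem_D (by norm_num) (by norm_num)
  have h2 : (1 / 2 : ℝ) • (unit : E) ∈ D E := smul_unit_mem_D (by norm_num) (by norm_num)
  have e1 : unit - (1 / 3 : ℝ) • (unit : E) = (2 / 3 : ℝ) • unit := by module
  have e2 : unit - (1 / 2 : ℝ) • (unit : E) = (1 / 2 : ℝ) • unit := by module
  have e3 : (1 / 3 : ℝ) • (unit : E) = (2 / 3 : ℝ) • (1 / 2 : ℝ) • unit := by module
  have hsum : (1 / 3 : ℝ) • (unit : E) + (1 / 3 : ℝ) • unit = (2 / 3 : ℝ) • unit := by module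
  -- One evaluation fixes the relation between the constants: at `x = y = e/3` both transformed
  -- arguments are `e/2`, and the logarithms cancel since `1/3 = (2/3)(1/2)`.
  have key := hs.eq ((1 / 3 : ℝ) • unit) ((1 / 3 : ℝ) • unit)
    ⟨h3, h3, by
      change (1 / 3 : ℝ) • (unit : E) + (1 / 3 : ℝ) • unit ∈ D E
      rw [hsum]; exact smul_unit_mem_D (by norm_num) (by norm_num)⟩
  have ew : ∀ {w : E → (E →L[ℝ] E)ˣ}, IsMultiplicationAlgorithm w → SatisfiesABC w →
      (↑(w ((2 / 3 : ℝ) • unit))⁻¹ : E →L[ℝ] E) ((1 / 3 : ℝ) • unit) = (1 / 2 : ℝ) • unit := by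
    intro w hw hABC
    rw [e3, inv_apply_smul (hABC.homogeneous _ (by norm_num) unit unit_mem_cone), map_smul,
      hw.inv_apply_self unit_mem_cone]
  rw [e1, ew hw hwABC, ew hw' hwABC', (hC _ h3).1, (hC _ h2).2.1, (hC _ h3).2.2.1,
    (hC _ h2).2.2.2, e1, e2, hr _ (by norm_num), hr _ (by norm_num), hr _ (by norm_num)] at key
  have hlog : Real.log (1 / 3) = Real.log (2 / 3) + Real.log (1 / 2) := by
    rw [← Real.log_mul (by norm_num) (by norm_num)]; norm_num
  rw [hlog] at key
  linear_combination key
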